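/- Let $(M^3,g)$ and $(N^2,h)$ be smooth Riemannian manifolds of dimensions $3$ and $2$ with Levi-Civita connections $\nabla$, $\nabla^N$, and let $\varphi:M\to N$ be a smooth Riemannian submersion (each $d\varphi_x$ is onto and is isometric on the orthogonal complement of its kernel). Let $\nabla^\varphi$ be the induced connection on $\varphi^{-1}TN$ and $R^N(X,Y)=\nabla^N_X\nabla^N_Y-\nabla^N_Y\nabla^N_X-\nabla^N_{[X,Y]}$. For a local orthonormal frame $\{e_i\}$ of $M$ and a section $W$ of $\varphi^{-1}TN$ put $$\tau(\varphi)=\sum_i\big(\nabla^\varphi_{e_i}d\varphi(e_i)-d\varphi(\nabla_{e_i}e_i)\big),\qquad \overline\triangle W=\sum_i\big(\nabla^\varphi_{e_i}\nabla^\varphi_{e_i}W-\nabla^\varphi_{\nabla_{e_i}e_i}W\big),$$ $$J(W)=\overline\triangle W-\sum_iR^N(W,d\varphi(e_i))d\varphi(e_i),\qquad \tau_3(\varphi)=J(\overline\triangle\tau(\varphi))-\sum_iR^N(\nabla^\varphi_{e_i}\tau(\varphi),\tau(\varphi))d\varphi(e_i).$$ The map $\varphi$ is called *triharmonic* on an open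 set $U\subseteq M$ if $\tau_3(\varphi)=0$ on $U$. Let $\{e_1,e_2,e_3\}$ be an adapted frame on an open set $U\subseteq M$ (for instance $U=M$): a smooth orthonormal frame with $d\varphi(e_3)=0$ and $d\varphi(e_i)=\epsilon_i\circ\varphi$ for $i=1,2$, where $\{\epsilon_1,\epsilon_2\}$ is a smooth orthonormal frame on an open set $V\subseteq N$ containing $\varphi(U)$. Let $f_1,f_2,k_1,k_2,\sigma$ be its integrability data, that is, smooth functions on $U$ with $$[e_1,e_3]=k_1e_3,\qquad [e_2,e_3]=k_2e_3,\qquad [e_1,e_2]=f_1e_1+f_2e_2-2\sigma e_3,$$ where $f_i=F_i\circ\varphi$ and $[\epsilon_1,\epsilon_2]=F_1\epsilon_1+F_2\epsilon_2$ with $F_1,F_2$ smooth on $V$. Let $\triangle^M$ be the Laplace–Beltrami operator of $M$ (the trace of the Hessian), let $K^N$ be the Gauss curvature of $N$ composed with $\varphi$, and put $$\begin{aligned}A={}&-\triangle^Mk_1-f_1e_1(k_2)-e_1(k_2f_1)-f_2e_2(k_2)-e_2(k_2f_2)+k_1k_2f_1+f_2k_2^2+k_1f_1^2+k_1f_2^2,\\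 B={}&-\triangle^Mk_2+f_1e_1(k_1)+e_1(k_1f_1)+f_2e_2(k_1)+e_2(k_1f_2)-k_1k_2f_2-f_1k_1^2+k_2f_1^2+k_2f_2^2.\end{aligned}$$ Then on $U$: 1. $\triangle^Mu=\sum_{i=1}^3e_ie_i(u)+f_1e_2(u)-f_2e_1(u)-k_1e_1(u)-k_2e_2(u)$ for every smooth function $u$ on $U$, and $K^N=e_1(f_2)-e_2(f_1)-f_1^2-f_2^2$; 2. $\tau(\varphi)=-k_1\epsilon_1-k_2\epsilon_2$ and $\overline\triangle\tau(\varphi)=A\epsilon_1+B\epsilon_2$ (with $\epsilon_i$ taken along $\varphi$); 3. $\varphi$ is triharmonic on $U$ if and only if, everywhere on $U$, $$\begin{aligned}&\triangle^MA+f_1e_1(B)+e_1(Bf_1)+f_2e_2(B)+e_2(Bf_2)-f_1k_1B-k_2f_2B\\&\quad-A\{K^N+f_1^2+f_2^2\}+K^N\big(-e_2(k_1)k_2+e_2(k_2)k_1-k_1^2f_2-k_2^2f_2\big)=0,\\ &\triangle^MB-f_1e_1(A)-e_1(Af_1)-f_2e_2(A)-e_2(Af_2)+f_1k_1A+f_2k_2A\\&\quad-B\{K^N+f_1^2+f_2^2\}+K^N\big(e_1(k_1)k_2-e_1(k_2)k_1+f_1k_2^2+f_1k_1^2\big)=0.\end{aligned}$$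 -/

import Mathlib

open Bundle VectorField
open scoped Manifold ContDiff

noncomputable section

/-! ## Riemannian geometry: Levi-Civita connection, curvature, Laplacian -/

section Riemannian

variable {E : Type*} [NormedAddCommGroup E] [NormedSpace ℝ E] [FiniteDimensional ℝ E]
  {H : Type*} [TopologicalSpace H] (I : ModelWithCorners ℝ E H)
  {M : Type*} [TopologicalSpace M] [ChartedSpace H M] [IsManifold I ∞ M]
  [RiemannianBundle (fun x : M ↦ TangentSpace I x)]

instance tangentSpace_finiteDimensional (x : M) : FiniteDimensional ℝ (TangentSpace I x) :=
  inferInstanceAs (FiniteDimensional ℝ E)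

/-- An orthonormal basis of the tangent space at `x`, with respect to the Riemannian metric. -/
def tangentONB (x : M) : OrthonormalBasis (Fin (Module.finrank ℝ (TangentSpace I x))) ℝ
    (TangentSpace I x) :=
  stdOrthonormalBasis ℝ (TangentSpace I x)

/-- The derivative `X(f)` of a real function along a vector field. -/
def dirDeriv (X : Π x : M, TangentSpace I x) (f : M → ℝ) : M → ℝ :=
  fun x ↦ mvfderiv I f x (X x)

/-- The right-hand side of the Koszul formula for `⟨∇_X Y, Z⟩`. -/
def koszul (X Y Z : Π x : M, TangentSpace I x) (x : M) : ℝ :=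
  (1 / 2 : ℝ) *
    (dirDeriv I X (fun z ↦ inner ℝ (Y z) (Z z)) x
      + dirDeriv I Y (fun z ↦ inner ℝ (X z) (Z z)) x
      - dirDeriv I Z (fun z ↦ inner ℝ (X z) (Y z)) x
      + inner ℝ (mlieBracket I X Y x) (Z x)
      - inner ℝ (mlieBracket I X Z x) (Y x)
      - inner ℝ (mlieBracket I Y Z x) (X x))

/-- The Levi-Civita connection: `leviCivita I Y x u` is `∇_u Y` at the point `x`, for a vector
field `Y` and a tangent vector `u` at `x`. It is the vector whose inner products with an
orthonormal basis are given by the Koszul formula; tangent vectors are extended to vector fields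
that are smooth near `x` (the formula does not depend on the extension). -/
def leviCivita (Y : Π x : M, TangentSpace I x) (x : M) (u : TangentSpace I x) :
    TangentSpace I x :=
  ∑ i, koszul I (FiberBundle.extend E u) Y (FiberBundle.extend E (tangentONB I x i)) x •
    tangentONB I x i

/-- The curvature tensor `R(u, w) z`, where `R(U, W) = ∇_U ∇_W - ∇_W ∇_U - ∇_[U, W]`. -/
def riemannCurvature (x : M) (u w z : TangentSpace I x) : TangentSpace I x :=
  letI U : Π y : M, TangentSpace I y := FiberBundle.extend E u
  letI W : Π y : M, TangentSpace I y := FiberBundle.extend E w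
  letI Z : Π y : M, TangentSpace I y := FiberBundle.extend E z
  leviCivita I (fun y ↦ leviCivita I Z y (W y)) x u
    - leviCivita I (fun y ↦ leviCivita I Z y (U y)) x w
    - leviCivita I Z x (mlieBracket I U W x)

/-- The Laplace-Beltrami operator on functions, the trace of the Hessian
`∇²f(X, X) = X(X(f)) - (∇_X X)(f)`. -/
def laplaceBeltrami (f : M → ℝ) (x : M) : ℝ :=
  ∑ i, letI X : Π y : M, TangentSpace I y := FiberBundle.extend E (tangentONB I x i)
    (dirDeriv I X (dirDeriv I X f) x - mvfderiv I f x (leviCivita I X x (X x)))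

end Riemannian

/-! ## Maps between Riemannian manifolds -/

section Maps

variable {E : Type*} [NormedAddCommGroup E] [NormedSpace ℝ E] [FiniteDimensional ℝ E]
  {H : Type*} [TopologicalSpace H] (I : ModelWithCorners ℝ E H)
  {M : Type*} [TopologicalSpace M] [ChartedSpace H M] [IsManifold I ∞ M]
  [RiemannianBundle (fun x : M ↦ TangentSpace I x)]
  {E' : Type*} [NormedAddCommGroup E'] [NormedSpace ℝ E'] [FiniteDimensional ℝ E']
  {H' : Type*} [TopologicalSpace H'] (J : ModelWithCorners ℝ E' H')
  {N : Type*} [TopologicalSpace N] [ChartedSpace H' N] [IsManifold J ∞ N]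
  [RiemannianBundle (fun y : N ↦ TangentSpace J y)]
  (φ : M → N)

/-- The connection on `φ⁻¹TN` induced by the Levi-Civita connection of `N`:
`inducedConnection I J φ V x u` is `∇^φ_u V` at `x`, for a section `V` of `φ⁻¹TN` and a tangent
vector `u` at `x`. Let `s_a` be the local frame of `TN` near `φ x` given by the standard
trivialization, and `V = ∑ V^a (s_a ∘ φ)`. Then
`∇^φ_u V = ∑ u(V^a) s_a + ∑ V^a ∇^N_{dφ u} s_a`; the two summands are the two sums. -/
def inducedConnection (V : Π x : M, TangentSpace J (φ x)) (x : M) (u : TangentSpace I x) :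
    TangentSpace J (φ x) :=
  letI t := trivializationAt E' (fun y : N ↦ TangentSpace J y) (φ x)
  t.symm (φ x) (mvfderiv I (fun z ↦ (t ⟨φ z, V z⟩).2) x u)
    + leviCivita J (FiberBundle.extend E' (V x)) (φ x) (mfderiv I J φ x u)

/-- The tension field `τ(φ)`, the trace of `∇dφ`. -/
def tensionField (x : M) : TangentSpace J (φ x) :=
  ∑ i, letI X : Π y : M, TangentSpace I y := FiberBundle.extend E (tangentONB I x i)
    (inducedConnection I J φ (fun z ↦ mfderiv I J φ z (X z)) x (X x)
      - mfderiv I J φ x (leviCivita I X x (X x)))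

/-- The rough Laplacian on sections of `φ⁻¹TN`, with the sign of the trace of the second covariant
derivative: `∑ ∇^φ_{e_i} ∇^φ_{e_i} V - ∇^φ_{∇_{e_i} e_i} V`. -/
def roughLaplacian (V : Π x : M, TangentSpace J (φ x)) (x : M) : TangentSpace J (φ x) :=
  ∑ i, letI X : Π y : M, TangentSpace I y := FiberBundle.extend E (tangentONB I x i)
    (inducedConnection I J φ (fun z ↦ inducedConnection I J φ V z (X z)) x (X x)
      - inducedConnection I J φ V x (leviCivita I X x (X x)))

/-- The operator `J(V) = Δ̄ V - ∑ R^N(V, dφ(e_i)) dφ(e_i)`. -/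
def jacobiOp (V : Π x : M, TangentSpace J (φ x)) (x : M) : TangentSpace J (φ x) :=
  roughLaplacian I J φ V x
    - ∑ i, riemannCurvature J (φ x) (V x) (mfderiv I J φ x (tangentONB I x i))
        (mfderiv I J φ x (tangentONB I x i))

/-- The tritension field
`τ₃(φ) = J(Δ̄ τ(φ)) - ∑ R^N(∇^φ_{e_i} τ(φ), τ(φ)) dφ(e_i)`. -/
def tritensionField (x : M) : TangentSpace J (φ x) :=
  jacobiOp I J φ (roughLaplacian I J φ (tensionField I J φ)) x
    - ∑ i, riemannCurvature J (φ x)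
        (inducedConnection I J φ (tensionField I J φ) x (tangentONB I x i))
        (tensionField I J φ x) (mfderiv I J φ x (tangentONB I x i))

/-- `φ` is triharmonic on `U`: its tritension field vanishes there. -/
def IsTriharmonicOn (U : Set M) : Prop :=
  ∀ x ∈ U, tritensionField I J φ x = 0

/-- A smooth Riemannian submersion: every differential is onto, and isometric on the orthogonal
complement of its kernel. -/
structure IsRiemannianSubmersion : Prop where
  contMDiff : ContMDiff I J ∞ φ
  surjective : ∀ x, Function.Surjective (mfderiv I J φ x)
  isometric : ∀ (x : M) (u v : TangentSpace I x),
    (∀ w, mfderiv I J φ x w = 0 → inner ℝ u w = 0) →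
    (∀ w, mfderiv I J φ x w = 0 → inner ℝ v w = 0) →
    inner ℝ (mfderiv I J φ x u) (mfderiv I J φ x v) = inner ℝ u v

end Maps

/-! ## Riemannian submersions from 3-manifolds to surfaces -/

section Surface

variable {N : Type*} [TopologicalSpace N] [ChartedSpace (EuclideanSpace ℝ (Fin 2)) N]
  [IsManifold (𝓡 2) ∞ N] [RiemannianBundle (fun y : N ↦ TangentSpace (𝓡 2) y)]

/-- The Gauss curvature `⟨R(b₀, b₁) b₁, b₀⟩` of a Riemannian surface, `b₀, b₁` being an orthonormal
basis of the tangent plane. -/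
def gaussCurvature (y : N) : ℝ :=
  letI b : OrthonormalBasis (Fin 2) ℝ (TangentSpace (𝓡 2) y) :=
    (tangentONB (𝓡 2) y).reindex
      (finCongr (finrank_euclideanSpace_fin : Module.finrank ℝ (EuclideanSpace ℝ (Fin 2)) = 2))
  inner ℝ (riemannCurvature (𝓡 2) y (b 0) (b 1) (b 1)) (b 0)

end Surface

section Frames

variable {M : Type*} [TopologicalSpace M] [ChartedSpace (EuclideanSpace ℝ (Fin 3)) M]
  [IsManifold (𝓡 3) ∞ M] [RiemannianBundle (fun x : M ↦ TangentSpace (𝓡 3) x)]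
  {N : Type*} [TopologicalSpace N] [ChartedSpace (EuclideanSpace ℝ (Fin 2)) N]
  [IsManifold (𝓡 2) ∞ N] [RiemannianBundle (fun y : N ↦ TangentSpace (𝓡 2) y)]

/-- `{e₁, e₂, e₃}` is a smooth orthonormal frame on the open set `U`, adapted to `φ`: the field
`e₃` is vertical, and `e₁`, `e₂` are `φ`-related to a smooth orthonormal frame `{ε₁, ε₂}` on an
open set `V` containing the image of `U`. -/
structure IsAdaptedFrame (φ : M → N) (U : Set M) (V : Set N)
    (e₁ e₂ e₃ : Π x : M, TangentSpace (𝓡 3) x) (ε₁ ε₂ : Π y : N, TangentSpace (𝓡 2) y) :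
    Prop where
  isOpen_source : IsOpen U
  isOpen_target : IsOpen V
  mapsTo : Set.MapsTo φ U V
  smooth_e₁ : ContMDiffOn (𝓡 3) (𝓡 3).tangent ∞ (fun x ↦ (⟨x, e₁ x⟩ : TangentBundle (𝓡 3) M)) U
  smooth_e₂ : ContMDiffOn (𝓡 3) (𝓡 3).tangent ∞ (fun x ↦ (⟨x, e₂ x⟩ : TangentBundle (𝓡 3) M)) U
  smooth_e₃ : ContMDiffOn (𝓡 3) (𝓡 3).tangent ∞ (fun x ↦ (⟨x, e₃ x⟩ : TangentBundle (𝓡 3) M)) U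
  smooth_ε₁ : ContMDiffOn (𝓡 2) (𝓡 2).tangent ∞ (fun y ↦ (⟨y, ε₁ y⟩ : TangentBundle (𝓡 2) N)) V
  smooth_ε₂ : ContMDiffOn (𝓡 2) (𝓡 2).tangent ∞ (fun y ↦ (⟨y, ε₂ y⟩ : TangentBundle (𝓡 2) N)) V
  orthonormal_e : ∀ x ∈ U, Orthonormal ℝ ![e₁ x, e₂ x, e₃ x]
  orthonormal_ε : ∀ y ∈ V, Orthonormal ℝ ![ε₁ y, ε₂ y]
  vertical : ∀ x ∈ U, mfderiv (𝓡 3) (𝓡 2) φ x (e₃ x) = 0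
  related₁ : ∀ x ∈ U, mfderiv (𝓡 3) (𝓡 2) φ x (e₁ x) = ε₁ (φ x)
  related₂ : ∀ x ∈ U, mfderiv (𝓡 3) (𝓡 2) φ x (e₂ x) = ε₂ (φ x)

/-- `f₁, f₂, k₁, k₂, σ` are the integrability data of an adapted frame. -/
structure IsIntegrabilityData (φ : M → N) (U : Set M) (V : Set N)
    (e₁ e₂ e₃ : Π x : M, TangentSpace (𝓡 3) x) (ε₁ ε₂ : Π y : N, TangentSpace (𝓡 2) y)
    (f₁ f₂ k₁ k₂ σ : M → ℝ) : Prop where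
  smooth_k₁ : ContMDiffOn (𝓡 3) 𝓘(ℝ, ℝ) ∞ k₁ U
  smooth_k₂ : ContMDiffOn (𝓡 3) 𝓘(ℝ, ℝ) ∞ k₂ U
  smooth_σ : ContMDiffOn (𝓡 3) 𝓘(ℝ, ℝ) ∞ σ U
  basic : ∃ F₁ F₂ : N → ℝ,
    ContMDiffOn (𝓡 2) 𝓘(ℝ, ℝ) ∞ F₁ V ∧ ContMDiffOn (𝓡 2) 𝓘(ℝ, ℝ) ∞ F₂ V ∧
    (∀ y ∈ V, mlieBracket (𝓡 2) ε₁ ε₂ y = F₁ y • ε₁ y + F₂ y • ε₂ y) ∧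
    (∀ x ∈ U, f₁ x = F₁ (φ x)) ∧ (∀ x ∈ U, f₂ x = F₂ (φ x))
  bracket₁₃ : ∀ x ∈ U, mlieBracket (𝓡 3) e₁ e₃ x = k₁ x • e₃ x
  bracket₂₃ : ∀ x ∈ U, mlieBracket (𝓡 3) e₂ e₃ x = k₂ x • e₃ x
  bracket₁₂ : ∀ x ∈ U,
    mlieBracket (𝓡 3) e₁ e₂ x = f₁ x • e₁ x + f₂ x • e₂ x - (2 * σ x) • e₃ x

/-- The function `A`. -/
def coeffA (e₁ e₂ : Π x : M, TangentSpace (𝓡 3) x) (f₁ f₂ k₁ k₂ : M → ℝ) (x : M) : ℝ :=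
  - laplaceBeltrami (𝓡 3) k₁ x
    - f₁ x * dirDeriv (𝓡 3) e₁ k₂ x - dirDeriv (𝓡 3) e₁ (fun z ↦ k₂ z * f₁ z) x
    - f₂ x * dirDeriv (𝓡 3) e₂ k₂ x - dirDeriv (𝓡 3) e₂ (fun z ↦ k₂ z * f₂ z) x
    + k₁ x * k₂ x * f₁ x + f₂ x * k₂ x ^ 2 + k₁ x * f₁ x ^ 2 + k₁ x * f₂ x ^ 2

/-- The function `B`. -/
def coeffB (e₁ e₂ : Π x : M, TangentSpace (𝓡 3) x) (f₁ f₂ k₁ k₂ : M → ℝ) (x : M) : ℝ :=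
  - laplaceBeltrami (𝓡 3) k₂ x
    + f₁ x * dirDeriv (𝓡 3) e₁ k₁ x + dirDeriv (𝓡 3) e₁ (fun z ↦ k₁ z * f₁ z) x
    + f₂ x * dirDeriv (𝓡 3) e₂ k₁ x + dirDeriv (𝓡 3) e₂ (fun z ↦ k₁ z * f₂ z) x
    - k₁ x * k₂ x * f₂ x - f₁ x * k₁ x ^ 2 + k₂ x * f₁ x ^ 2 + k₂ x * f₂ x ^ 2

end Frames

end

noncomputable section

set_option linter.unusedSectionVars false

section LeviCivita

open Filter Topology

variable {E : Type*} [NormedAddCommGroup E] [NormedSpace ℝ E] [FiniteDimensional ℝ E]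
  {H : Type*} [TopologicalSpace H] {I : ModelWithCorners ℝ E H}
  {M : Type*} [TopologicalSpace M] [ChartedSpace H M] [IsManifold I ∞ M]
  [RiemannianBundle (fun x : M ↦ TangentSpace I x)]

omit [FiniteDimensional ℝ E] [IsManifold I ∞ M] [RiemannianBundle (fun x : M ↦ TangentSpace I x)] in
lemma mvfderiv_congr {F : Type*} [NormedAddCommGroup F] [NormedSpace ℝ F] {f g : M → F} {x : M}
    (h : f =ᶠ[𝓝 x] g) : mvfderiv I f x = mvfderiv I g x := by
  simp only [mvfderiv]
  rw [h.mfderiv_eq, h.self_of_nhds]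

lemma koszul_congr_middle {X Y Y' Z : Π x : M, TangentSpace I x} {x : M}
    (h : ∀ᶠ z in 𝓝 x, Y z = Y' z) : koszul I X Y Z x = koszul I X Y' Z x := by
  have hx := h.self_of_nhds
  simp only [koszul, dirDeriv]
  rw [mvfderiv_congr (f := fun z ↦ inner ℝ (Y z) (Z z)) (g := fun z ↦ inner ℝ (Y' z) (Z z))
      (h.mono fun z hz ↦ by simp [hz]),
    mvfderiv_congr (f := fun z ↦ inner ℝ (X z) (Y z)) (g := fun z ↦ inner ℝ (X z) (Y' z))
      (h.mono fun z hz ↦ by simp [hz]),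
    Filter.EventuallyEq.mlieBracket_vectorField_eq (EventuallyEq.refl _ X) h,
    Filter.EventuallyEq.mlieBracket_vectorField_eq h (EventuallyEq.refl _ Z), hx]

lemma leviCivita_congr {Y Y' : Π x : M, TangentSpace I x} {x : M}
    (h : ∀ᶠ z in 𝓝 x, Y z = Y' z) (u : TangentSpace I x) :
    leviCivita I Y x u = leviCivita I Y' x u := by
  simp only [leviCivita, koszul_congr_middle h]

variable [IsContMDiffRiemannianBundle I ∞ E (fun x : M ↦ TangentSpace I x)]

lemma mdifferentiableAt_inner {X Y : Π x : M, TangentSpace I x} {x : M}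
    (hX : MDiffAt (T% X) x) (hY : MDiffAt (T% Y) x) :
    MDiffAt (fun z ↦ (inner ℝ (X z) (Y z) : ℝ)) x :=
  MDifferentiableAt.inner_bundle (F := E) (E := fun x : M ↦ TangentSpace I x) hX hY

theorem koszul_tensorial_left {Y Z : Π x : M, TangentSpace I x} {x : M}
    (hY : MDiffAt (T% Y) x) (hZ : MDiffAt (T% Z) x) :
    TensorialAt I E (fun X ↦ koszul I X Y Z x) x where
  smul {f X} hf hX := by
    simp only [koszul, dirDeriv]
    have h1 : (fun z ↦ inner ℝ ((f • X) z) (Z z)) = f * fun z ↦ inner ℝ (X z) (Z z) := by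
      ext z; simp [inner_smul_left]
    have h2 : (fun z ↦ inner ℝ ((f • X) z) (Y z)) = f * fun z ↦ inner ℝ (X z) (Y z) := by
      ext z; simp [inner_smul_left]
    rw [h1, h2, mvfderiv_mul hf (mdifferentiableAt_inner hX hZ),
      mvfderiv_mul hf (mdifferentiableAt_inner hX hY),
      mlieBracket_smul_left hf hX, mlieBracket_smul_left hf hX]
    simp [inner_add_left, inner_smul_left, inner_smul_right]
    ring
  add {X X'} hX hX' := by
    simp only [koszul, dirDeriv]
    have h1 : (fun z ↦ inner ℝ ((X + X') z) (Z z))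
        = (fun z ↦ inner ℝ (X z) (Z z)) + fun z ↦ inner ℝ (X' z) (Z z) := by
      ext z; simp [inner_add_left]
    have h2 : (fun z ↦ inner ℝ ((X + X') z) (Y z))
        = (fun z ↦ inner ℝ (X z) (Y z)) + fun z ↦ inner ℝ (X' z) (Y z) := by
      ext z; simp [inner_add_left]
    rw [h1, h2, mvfderiv_add (mdifferentiableAt_inner hX hZ) (mdifferentiableAt_inner hX' hZ),
      mvfderiv_add (mdifferentiableAt_inner hX hY) (mdifferentiableAt_inner hX' hY),
      mlieBracket_add_left hX hX', mlieBracket_add_left hX hX']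
    simp [inner_add_left, inner_add_right]
    ring

theorem koszul_tensorial_right {X Y : Π x : M, TangentSpace I x} {x : M}
    (hX : MDiffAt (T% X) x) (hY : MDiffAt (T% Y) x) :
    TensorialAt I E (fun Z ↦ koszul I X Y Z x) x where
  smul {f Z} hf hZ := by
    simp only [koszul, dirDeriv]
    have h1 : (fun z ↦ inner ℝ (Y z) ((f • Z) z)) = f * fun z ↦ inner ℝ (Y z) (Z z) := by
      ext z; simp [inner_smul_right]
    have h2 : (fun z ↦ inner ℝ (X z) ((f • Z) z)) = f * fun z ↦ inner ℝ (X z) (Z z) := by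
      ext z; simp [inner_smul_right]
    rw [h1, h2, mvfderiv_mul hf (mdifferentiableAt_inner hY hZ),
      mvfderiv_mul hf (mdifferentiableAt_inner hX hZ),
      mlieBracket_smul_right hf hZ, mlieBracket_smul_right hf hZ]
    simp [inner_add_left, inner_smul_left, inner_smul_right]
    rw [real_inner_comm (Z x) (Y x), real_inner_comm (Z x) (X x)]
    ring
  add {Z Z'} hZ hZ' := by
    simp only [koszul, dirDeriv]
    have h1 : (fun z ↦ inner ℝ (Y z) ((Z + Z') z))
        = (fun z ↦ inner ℝ (Y z) (Z z)) + fun z ↦ inner ℝ (Y z) (Z' z) := by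
      ext z; simp [inner_add_right]
    have h2 : (fun z ↦ inner ℝ (X z) ((Z + Z') z))
        = (fun z ↦ inner ℝ (X z) (Z z)) + fun z ↦ inner ℝ (X z) (Z' z) := by
      ext z; simp [inner_add_right]
    rw [h1, h2, mvfderiv_add (mdifferentiableAt_inner hY hZ) (mdifferentiableAt_inner hY hZ'),
      mvfderiv_add (mdifferentiableAt_inner hX hZ) (mdifferentiableAt_inner hX hZ'),
      mlieBracket_add_right hZ hZ', mlieBracket_add_right hZ hZ']
    simp [inner_add_left, inner_add_right]
    ring

lemma koszul_add_middle {X Y Y' Z : Π x : M, TangentSpace I x} {x : M}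
    (hX : MDiffAt (T% X) x) (hY : MDiffAt (T% Y) x) (hY' : MDiffAt (T% Y') x)
    (hZ : MDiffAt (T% Z) x) :
    koszul I X (Y + Y') Z x = koszul I X Y Z x + koszul I X Y' Z x := by
  simp only [koszul, dirDeriv]
  have h1 : (fun z ↦ inner ℝ ((Y + Y') z) (Z z))
      = (fun z ↦ inner ℝ (Y z) (Z z)) + fun z ↦ inner ℝ (Y' z) (Z z) := by
    ext z; simp [inner_add_left]
  have h2 : (fun z ↦ inner ℝ (X z) ((Y + Y') z))
      = (fun z ↦ inner ℝ (X z) (Y z)) + fun z ↦ inner ℝ (X z) (Y' z) := by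
    ext z; simp [inner_add_right]
  rw [h1, h2, mvfderiv_add (mdifferentiableAt_inner hY hZ) (mdifferentiableAt_inner hY' hZ),
    mvfderiv_add (mdifferentiableAt_inner hX hY) (mdifferentiableAt_inner hX hY'),
    mlieBracket_add_right hY hY', mlieBracket_add_left hY hY']
  simp [inner_add_left, inner_add_right]
  ring

lemma koszul_smul_middle {f : M → ℝ} {X Y Z : Π x : M, TangentSpace I x} {x : M}
    (hf : MDiffAt f x) (hX : MDiffAt (T% X) x) (hY : MDiffAt (T% Y) x) (hZ : MDiffAt (T% Z) x) :
    koszul I X (f • Y) Z x = f x * koszul I X Y Z x + mvfderiv I f x (X x) * inner ℝ (Y x) (Z x) := by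
  simp only [koszul, dirDeriv]
  have h1 : (fun z ↦ inner ℝ ((f • Y) z) (Z z)) = f * fun z ↦ inner ℝ (Y z) (Z z) := by
    ext z; simp [inner_smul_left]
  have h2 : (fun z ↦ inner ℝ (X z) ((f • Y) z)) = f * fun z ↦ inner ℝ (X z) (Y z) := by
    ext z; simp [inner_smul_right]
  rw [h1, h2, mvfderiv_mul hf (mdifferentiableAt_inner hY hZ),
    mvfderiv_mul hf (mdifferentiableAt_inner hX hY),
    mlieBracket_smul_right hf hY, mlieBracket_smul_left hf hY]
  simp [inner_add_left, inner_smul_left, inner_smul_right]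
  rw [real_inner_comm (Y x) (X x)]
  ring

/-- The Koszul formula characterizes the Levi-Civita connection. -/
lemma inner_leviCivita {X Y Z : Π x : M, TangentSpace I x} {x : M}
    (hX : MDiffAt (T% X) x) (hY : MDiffAt (T% Y) x) (hZ : MDiffAt (T% Z) x) :
    inner ℝ (leviCivita I Y x (X x)) (Z x) = koszul I X Y Z x := by
  have h (W : TangentSpace I x) := koszul_tensorial_right (X := FiberBundle.extend E (X x)) (Y := Y)
    (x := x) (FiberBundle.mdifferentiableAt_extend ..) hY
  have h1 : koszul I (FiberBundle.extend E (X x)) Y Z x = koszul I X Y Z x :=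
    (koszul_tensorial_left hY hZ).pointwise (FiberBundle.mdifferentiableAt_extend ..) hX (by simp)
  have key := (TensorialAt.mkHom_apply (koszul_tensorial_right
    (X := FiberBundle.extend E (X x)) (Y := Y) (x := x) (FiberBundle.mdifferentiableAt_extend ..) hY) hZ)
  rw [← h1, ← key, leviCivita, sum_inner]
  conv_rhs => rw [← (tangentONB I x).sum_repr' (Z x)]
  rw [map_sum]
  refine Finset.sum_congr rfl fun i _ ↦ ?_
  rw [map_smul, TensorialAt.mkHom_apply_eq_extend, inner_smul_left]
  simp [mul_comm]

lemma ext_inner_extend {x : M} {v w : TangentSpace I x}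
    (h : ∀ Z : Π x : M, TangentSpace I x, MDiffAt (T% Z) x → inner ℝ v (Z x) = inner ℝ w (Z x)) :
    v = w := by
  refine ext_inner_right ℝ fun z ↦ ?_
  simpa using h (FiberBundle.extend E z) (FiberBundle.mdifferentiableAt_extend ..)

lemma leviCivita_isLinearMap {Y : Π x : M, TangentSpace I x} {x : M} (hY : MDiffAt (T% Y) x) :
    IsLinearMap ℝ (leviCivita I Y x) := by
  have key (u : TangentSpace I x) {Z : Π x : M, TangentSpace I x} (hZ : MDiffAt (T% Z) x) :
      inner ℝ (leviCivita I Y x u) (Z x) =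
        TensorialAt.mkHom _ x (koszul_tensorial_left hY hZ) u := by
    have := inner_leviCivita (X := FiberBundle.extend E u) (FiberBundle.mdifferentiableAt_extend ..) hY hZ
    rw [TensorialAt.mkHom_apply_eq_extend]
    simpa using this
  constructor
  · intro u v
    refine ext_inner_extend fun Z hZ ↦ ?_
    rw [inner_add_left, key _ hZ, key _ hZ, key _ hZ, map_add]
  · intro c u
    refine ext_inner_extend fun Z hZ ↦ ?_
    rw [inner_smul_left, key _ hZ, key _ hZ, map_smul]
    simp

lemma leviCivita_add {Y Y' : Π x : M, TangentSpace I x} {x : M} (hY : MDiffAt (T% Y) x)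
    (hY' : MDiffAt (T% Y') x) (u : TangentSpace I x) :
    leviCivita I (Y + Y') x u = leviCivita I Y x u + leviCivita I Y' x u := by
  refine ext_inner_extend fun Z hZ ↦ ?_
  have hu : FiberBundle.extend E u x = u := by simp
  rw [← hu, inner_add_left, inner_leviCivita (FiberBundle.mdifferentiableAt_extend ..) hY hZ,
    inner_leviCivita (FiberBundle.mdifferentiableAt_extend ..) hY' hZ,
    inner_leviCivita (FiberBundle.mdifferentiableAt_extend ..) (mdifferentiableAt_add_section hY hY') hZ,
    koszul_add_middle (FiberBundle.mdifferentiableAt_extend ..) hY hY' hZ]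

lemma leviCivita_smul {f : M → ℝ} {Y : Π x : M, TangentSpace I x} {x : M} (hf : MDiffAt f x)
    (hY : MDiffAt (T% Y) x) (u : TangentSpace I x) :
    leviCivita I (f • Y) x u = f x • leviCivita I Y x u + mvfderiv I f x u • Y x := by
  refine ext_inner_extend fun Z hZ ↦ ?_
  have hu : FiberBundle.extend E u x = u := by simp
  rw [← hu, inner_add_left, inner_smul_left, inner_smul_left,
    inner_leviCivita (FiberBundle.mdifferentiableAt_extend ..) hY hZ,
    inner_leviCivita (FiberBundle.mdifferentiableAt_extend ..) (hf.smul_section hY) hZ,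
    koszul_smul_middle hf (FiberBundle.mdifferentiableAt_extend ..) hY hZ]
  simp

end LeviCivita

section Smoothness

open Filter Topology

variable {E : Type*} [NormedAddCommGroup E] [NormedSpace ℝ E]
  {H : Type*} [TopologicalSpace H] {I : ModelWithCorners ℝ E H}
  {M : Type*} [TopologicalSpace M] [ChartedSpace H M] [IsManifold I ∞ M]
  {E' : Type*} [NormedAddCommGroup E'] [NormedSpace ℝ E']
  {H' : Type*} [TopologicalSpace H'] {J : ModelWithCorners ℝ E' H'}
  {N : Type*} [TopologicalSpace N] [ChartedSpace H' N] [IsManifold J ∞ N]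

lemma contMDiffAt_mfderiv_apply {φ : M → N} {X : Π x : M, TangentSpace I x} {x : M} {m : ℕ}
    (hφ : ContMDiffAt I J (m + 1) φ x) (hX : ContMDiffAt I I.tangent m (T% X) x) :
    ContMDiffAt I J.tangent m (fun z ↦ (⟨φ z, mfderiv I J φ z (X z)⟩ : TangentBundle J N)) x := by
  have hφ' : ContMDiffAt I J ((m + 1 : ℕ) : WithTop ℕ∞) φ x := by exact_mod_cast hφ
  obtain ⟨u, hu, hφu⟩ := (contMDiffAt_iff_contMDiffOn_nhds (by simp)).1 hφ'
  obtain ⟨o, hou, ho, hxo⟩ := mem_nhds_iff.1 hu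
  have h1 := (hφu.mono hou).contMDiffOn_tangentMapWithin (m := m) (by norm_cast)
    ho.uniqueMDiffOn
  have h2 : ContMDiffAt I.tangent J.tangent m (tangentMapWithin I J φ o)
      (⟨x, X x⟩ : TangentBundle I M) :=
    h1.contMDiffAt ((ho.preimage (FiberBundle.continuous_proj E (TangentSpace I))).mem_nhds hxo)
  have h3 := ContMDiffAt.comp x h2 hX
  refine h3.congr_of_eventuallyEq ?_
  filter_upwards [ho.mem_nhds hxo] with z hz
  simp only [Function.comp, tangentMapWithin]
  rw [mfderivWithin_of_isOpen ho hz]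

lemma contMDiffAt_dirDeriv {f : M → ℝ} {X : Π x : M, TangentSpace I x} {x : M} {m : ℕ}
    (hf : ContMDiffAt I 𝓘(ℝ, ℝ) (m + 1) f x) (hX : ContMDiffAt I I.tangent m (T% X) x) :
    ContMDiffAt I 𝓘(ℝ, ℝ) m (dirDeriv I X f) x :=
  (contMDiff_snd_tangentBundle_modelSpace ℝ 𝓘(ℝ, ℝ)).contMDiffAt.comp x
    (contMDiffAt_mfderiv_apply hf hX)

lemma ContMDiffOn.dirDeriv {f : M → ℝ} {X : Π x : M, TangentSpace I x} {U : Set M} (hU : IsOpen U)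
    (hf : ContMDiffOn I 𝓘(ℝ, ℝ) ∞ f U) (hX : ContMDiffOn I I.tangent ∞ (T% X) U) :
    ContMDiffOn I 𝓘(ℝ, ℝ) ∞ (dirDeriv I X f) U := by
  refine contMDiffOn_infty.2 fun m x hx ↦ ContMDiffAt.contMDiffWithinAt ?_
  refine contMDiffAt_dirDeriv ?_ ?_
  · exact ((hf.contMDiffAt (hU.mem_nhds hx)).of_le (by exact_mod_cast le_top))
  · exact ((hX.contMDiffAt (hU.mem_nhds hx)).of_le (by exact_mod_cast le_top))

/-- The Lie bracket of two vector fields acts on functions as the commutator. -/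
lemma dirDeriv_mlieBracket [CompleteSpace E] [Nontrivial E] {f : M → ℝ}
    {U V : Π x : M, TangentSpace I x} {x : M} (hf : ContMDiffAt I 𝓘(ℝ, ℝ) 2 f x)
    (hU : ContMDiffAt I I.tangent 2 (T% U) x) (hV : ContMDiffAt I I.tangent 2 (T% V) x) :
    dirDeriv I (mlieBracket I U V) f x =
      dirDeriv I U (dirDeriv I V f) x - dirDeriv I V (dirDeriv I U f) x := by
  obtain ⟨w, hw⟩ : ∃ w : TangentSpace I x, w ≠ 0 := exists_ne (0 : E)
  let W : Π z : M, TangentSpace I z := FiberBundle.extend E w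
  have hWx : W x = w := FiberBundle.extend_apply_self ..
  have : IsManifold I 3 M := inferInstance
  have : IsManifold I (minSmoothness ℝ 3) M := by simpa using ‹IsManifold I 3 M›
  have : IsManifold I (((2 : ℕ∞) : WithTop ℕ∞) + 1) M := by
    convert ‹IsManifold I 3 M› using 1
    norm_num
  have hf2 : ContMDiffAt I 𝓘(ℝ, ℝ) ((1 : ℕ) + 1) f x := by
    convert hf using 1
    norm_num
  have hW : ContMDiffAt I I.tangent 2 (T% W) x := by
    have : ContMDiffVectorBundle 2 E (TangentSpace I : M → Type _) I := inferInstance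
    exact FiberBundle.contMDiffAt_extend ..
  have hfW : ContMDiffAt I I.tangent 2 (T% (f • W)) x := hf.smul_section hW
  have one {X : Π z : M, TangentSpace I z} (hX : ContMDiffAt I I.tangent 2 (T% X) x) :
      MDiffAt (T% X) x := hX.mdifferentiableAt two_ne_zero
  have hfd : MDiffAt f x := hf.mdifferentiableAt two_ne_zero
  have hder {X : Π z : M, TangentSpace I z} (hX : ContMDiffAt I I.tangent 2 (T% X) x) :
      MDiffAt (dirDeriv I X f) x :=
    (contMDiffAt_dirDeriv (m := 1) hf2 (hX.of_le (by norm_num))).mdifferentiableAt one_ne_zero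
  have hbr {X Y : Π z : M, TangentSpace I z} (hX : ContMDiffAt I I.tangent 2 (T% X) x)
      (hY : ContMDiffAt I I.tangent 2 (T% Y) x) : MDiffAt (T% (mlieBracket I X Y)) x := by
    have := ContMDiffAt.mlieBracket_vectorField (m := 1) (n := 2) hX hY
      (by simp; norm_num)
    exact this.mdifferentiableAt one_ne_zero
  have hev {X : Π z : M, TangentSpace I z} :
      ∀ᶠ z in 𝓝 x, mlieBracket I X (f • W) z =
        (dirDeriv I X f • W + f • mlieBracket I X W) z := by
    filter_upwards [(contMDiffAt_iff_contMDiffAt_nhds (by simp)).1 hf,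
      (contMDiffAt_iff_contMDiffAt_nhds (by simp)).1 hW] with z hfz hWz
    exact mlieBracket_smul_right (hfz.mdifferentiableAt two_ne_zero)
      (hWz.mdifferentiableAt two_ne_zero)
  have hexp {X Y : Π z : M, TangentSpace I z} (hX : ContMDiffAt I I.tangent 2 (T% X) x)
      (hY : ContMDiffAt I I.tangent 2 (T% Y) x) :
      mlieBracket I X (mlieBracket I Y (f • W)) x =
        dirDeriv I X (dirDeriv I Y f) x • w + dirDeriv I Y f x • mlieBracket I X W x +
          (dirDeriv I X f x • mlieBracket I Y W x + f x • mlieBracket I X (mlieBracket I Y W) x) := by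
    rw [Filter.EventuallyEq.mlieBracket_vectorField_eq (EventuallyEq.refl _ X) hev,
      mlieBracket_add_right ((hder hY).smul_section (one hW)) (hfd.smul_section (hbr hY hW)),
      mlieBracket_smul_right (hder hY) (one hW), mlieBracket_smul_right hfd (hbr hY hW), hWx]
    rfl
  have j1 := leibniz_identity_mlieBracket_apply (I := I) (U := U) (V := V) (W := f • W) (x := x)
    (by simpa using hU) (by simpa using hV) (by simpa using hfW)
  have j2 := leibniz_identity_mlieBracket_apply (I := I) (U := U) (V := V) (W := W) (x := x)
    (by simpa using hU) (by simpa using hV) (by simpa using hW)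
  rw [hexp hU hV, hexp hV hU, mlieBracket_smul_right hfd (one hW), j2, hWx] at j1
  have j3 : (dirDeriv I U (dirDeriv I V f) x - dirDeriv I V (dirDeriv I U f) x
      - dirDeriv I (mlieBracket I U V) f x) • w = 0 := by
    have : dirDeriv I (mlieBracket I U V) f x = mvfderiv I f x (mlieBracket I U V x) := rfl
    rw [this, ← sub_eq_zero.2 j1]
    module
  linarith [(smul_eq_zero.1 j3).resolve_right hw]

end Smoothness

section Connection

open Filter Topology

variable {E : Type*} [NormedAddCommGroup E] [NormedSpace ℝ E]
  {H : Type*} [TopologicalSpace H] {I : ModelWithCorners ℝ E H}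
  {M : Type*} [TopologicalSpace M] [ChartedSpace H M]
  {W : M → Type*} [∀ z, AddCommGroup (W z)] [∀ z, Module ℝ (W z)] {x : M}

/-- The operation `D s u = ∇_u s` satisfies the rules of a connection at the point `x`, for the
sections `s` with the property `P`. -/
structure IsConnectionAt (I : ModelWithCorners ℝ E H) (x : M) (P : (Π z, W z) → Prop)
    (D : (Π z, W z) → TangentSpace I x → W x) : Prop where
  zero_mem : P 0
  add_mem {s t} : P s → P t → P (s + t)
  smul_mem {f : M → ℝ} {s} : MDifferentiableAt I 𝓘(ℝ, ℝ) f x → P s → P (f • s)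
  congr {s t} : (∀ᶠ z in 𝓝 x, s z = t z) → D s = D t
  map_add {s t} : P s → P t → ∀ u, D (s + t) u = D s u + D t u
  map_smul {f : M → ℝ} {s} : MDifferentiableAt I 𝓘(ℝ, ℝ) f x → P s →
    ∀ u, D (f • s) u = f x • D s u + mvfderiv I f x u • s x
  isLinearMap {s} : P s → IsLinearMap ℝ (D s)

namespace IsConnectionAt

variable {P : (Π z, W z) → Prop} {D : (Π z, W z) → TangentSpace I x → W x}

lemma map_zero (h : IsConnectionAt I x P D) (u : TangentSpace I x) : D 0 u = 0 := by
  have := h.map_add h.zero_mem h.zero_mem u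
  simpa using this

lemma sum_smul {ι : Type*} (h : IsConnectionAt I x P D) (t : Finset ι) {c : ι → M → ℝ}
    {s : ι → Π z, W z} (hc : ∀ i, MDifferentiableAt I 𝓘(ℝ, ℝ) (c i) x) (hs : ∀ i, P (s i)) :
    P (∑ i ∈ t, c i • s i) ∧ ∀ u, D (∑ i ∈ t, c i • s i) u =
      ∑ i ∈ t, (c i x • D (s i) u + mvfderiv I (c i) x u • s i x) := by
  classical
  induction t using Finset.induction_on with
  | empty => simpa using ⟨h.zero_mem, h.map_zero⟩
  | insert a t ha ih =>
    simp only [Finset.sum_insert ha]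
    have ha' := h.smul_mem (hc a) (hs a)
    refine ⟨h.add_mem ha' ih.1, fun u ↦ ?_⟩
    rw [h.map_add ha' ih.1, h.map_smul (hc a) (hs a), ih.2]

end IsConnectionAt

end Connection

section Trace

open Filter Topology

variable {E : Type*} [NormedAddCommGroup E] [NormedSpace ℝ E] [FiniteDimensional ℝ E]
  {H : Type*} [TopologicalSpace H] {I : ModelWithCorners ℝ E H}
  {M : Type*} [TopologicalSpace M] [ChartedSpace H M] [IsManifold I ∞ M]
  [RiemannianBundle (fun x : M ↦ TangentSpace I x)]
  [IsContMDiffRiemannianBundle I ∞ E (fun x : M ↦ TangentSpace I x)]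

lemma isConnectionAt_leviCivita (x : M) :
    IsConnectionAt I x (fun Y : Π z : M, TangentSpace I z ↦ MDiffAt (T% Y) x)
      (fun Y ↦ leviCivita I Y x) where
  zero_mem := mdifferentiable_zeroSection .. 
  add_mem := mdifferentiableAt_add_section
  smul_mem := MDifferentiableAt.smul_section
  congr h := funext fun u ↦ leviCivita_congr h u
  map_add := leviCivita_add
  map_smul := leviCivita_smul
  isLinearMap := leviCivita_isLinearMap

/-- The trace of the covariant derivative of a family `L` of linear maps on the tangent spaces can
be computed in any local orthonormal frame. -/
lemma trace_covariant_derivative {W : M → Type*} [∀ z, AddCommGroup (W z)] [∀ z, Module ℝ (W z)]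
    {x : M} {P : (Π z, W z) → Prop} {D : (Π z, W z) → TangentSpace I x → W x}
    (hD : IsConnectionAt I x P D) {L : Π z : M, TangentSpace I z → W z}
    (hL : ∀ᶠ z in 𝓝 x, IsLinearMap ℝ (L z)) {ι : Type*} [Fintype ι]
    {e : ι → Π z : M, TangentSpace I z} (he : ∀ i, MDiffAt (T% (e i)) x)
    (hsum : ∀ᶠ z in 𝓝 x, ∀ v : TangentSpace I z, ∑ i, (inner ℝ (e i z) v : ℝ) • e i z = v)
    (hLe : ∀ i, P (fun z ↦ L z (e i z))) :
    ∑ a, (D (fun z ↦ L z (FiberBundle.extend E (tangentONB I x a) z))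
          (FiberBundle.extend E (tangentONB I x a) x)
        - L x (leviCivita I (FiberBundle.extend E (tangentONB I x a)) x
          (FiberBundle.extend E (tangentONB I x a) x))) =
      ∑ i, (D (fun z ↦ L z (e i z)) (e i x) - L x (leviCivita I (e i) x (e i x))) := by
  classical
  have hLx : IsLinearMap ℝ (L x) := hL.self_of_nhds
  let T (i : ι) : TangentSpace I x →ₗ[ℝ] W x :=
    IsLinearMap.mk' _ (hD.isLinearMap (hLe i)) -
      (IsLinearMap.mk' _ hLx) ∘ₗ (IsLinearMap.mk' _ (leviCivita_isLinearMap (he i)))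
  have hT (i : ι) (u : TangentSpace I x) :
      T i u = D (fun z ↦ L z (e i z)) u - L x (leviCivita I (e i) x u) := rfl
  have key (Y : Π z : M, TangentSpace I z) (hY : MDiffAt (T% Y) x) (u : TangentSpace I x) :
      D (fun z ↦ L z (Y z)) u - L x (leviCivita I Y x u) =
        ∑ i, (inner ℝ (e i x) (Y x) : ℝ) • T i u := by
    let c (i : ι) (z : M) : ℝ := inner ℝ (e i z) (Y z)
    have hc (i : ι) : MDifferentiableAt I 𝓘(ℝ, ℝ) (c i) x := mdifferentiableAt_inner (he i) hY
    have h1 : ∀ᶠ z in 𝓝 x, Y z = (∑ i, c i • e i) z := by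
      filter_upwards [hsum] with z hz
      simp [c, hz]
    have h2 : ∀ᶠ z in 𝓝 x, L z (Y z) = (∑ i, c i • fun z ↦ L z (e i z)) z := by
      filter_upwards [h1, hL] with z hz hLz
      have := map_sum (IsLinearMap.mk' _ hLz) (fun i ↦ c i z • e i z) Finset.univ
      simp only [IsLinearMap.mk'_apply] at this
      rw [hz]
      simpa [hLz.map_smul] using this
    rw [hD.congr h2, leviCivita_congr h1, (hD.sum_smul _ hc hLe).2,
      ((isConnectionAt_leviCivita x).sum_smul _ hc he).2]
    have h3 := map_sum (IsLinearMap.mk' _ hLx)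
      (fun i ↦ c i x • leviCivita I (e i) x u + mvfderiv I (c i) x u • e i x) Finset.univ
    simp only [IsLinearMap.mk'_apply] at h3
    rw [h3, ← Finset.sum_sub_distrib]
    refine Finset.sum_congr rfl fun i _ ↦ ?_
    rw [hLx.map_add, hLx.map_smul, hLx.map_smul, hT, smul_sub]
    abel
  calc
    _ = ∑ a, ∑ i, (inner ℝ (e i x) (tangentONB I x a) : ℝ) • T i (tangentONB I x a) := by
      refine Finset.sum_congr rfl fun a _ ↦ ?_
      rw [key _ (FiberBundle.mdifferentiableAt_extend ..)]
      simp
    _ = ∑ i, T i (e i x) := by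
      rw [Finset.sum_comm]
      refine Finset.sum_congr rfl fun i _ ↦ ?_
      conv_rhs => rw [← (tangentONB I x).sum_repr' (e i x)]
      rw [map_sum]
      refine Finset.sum_congr rfl fun a _ ↦ ?_
      rw [map_smul, real_inner_comm]
    _ = _ := rfl

end Trace

section InducedConnection

open Filter Topology

variable {E : Type*} [NormedAddCommGroup E] [NormedSpace ℝ E]
  {H : Type*} [TopologicalSpace H] {I : ModelWithCorners ℝ E H}
  {M : Type*} [TopologicalSpace M] [ChartedSpace H M]
  {E' : Type*} [NormedAddCommGroup E'] [NormedSpace ℝ E'] [FiniteDimensional ℝ E']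
  {H' : Type*} [TopologicalSpace H'] {J : ModelWithCorners ℝ E' H'}
  {N : Type*} [TopologicalSpace N] [ChartedSpace H' N] [IsManifold J ∞ N]
  [RiemannianBundle (fun y : N ↦ TangentSpace J y)]
  {φ : M → N} {x : M}

variable (I J) in
/-- The section `V` of `φ⁻¹TN` is differentiable at `x`. -/
def MDiffAlongAt (V : Π z : M, TangentSpace J (φ z)) (x : M) : Prop :=
  MDifferentiableAt I J.tangent (fun z ↦ (⟨φ z, V z⟩ : TangentBundle J N)) x

lemma mdiffAlongAt_iff (hφ : MDifferentiableAt I J φ x) {V : Π z : M, TangentSpace J (φ z)} :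
    MDiffAlongAt I J V x ↔ MDifferentiableAt I 𝓘(ℝ, E')
      (fun z ↦ (trivializationAt E' (fun y : N ↦ TangentSpace J y) (φ x) ⟨φ z, V z⟩).2) x := by
  rw [MDiffAlongAt, mdifferentiableAt_totalSpace]
  exact and_iff_right hφ

lemma eventually_mem_baseSet (hφ : MDifferentiableAt I J φ x) :
    ∀ᶠ z in 𝓝 x, φ z ∈ (trivializationAt E' (fun y : N ↦ TangentSpace J y) (φ x)).baseSet :=
  hφ.continuousAt.eventually_mem ((Trivialization.open_baseSet _).mem_nhds
    (FiberBundle.mem_baseSet_trivializationAt E' (fun y : N ↦ TangentSpace J y) _))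

lemma trivializationAt_add {y z : N} (v w : TangentSpace J z)
    (hz : z ∈ (trivializationAt E' (fun y : N ↦ TangentSpace J y) y).baseSet) :
    (trivializationAt E' (fun y : N ↦ TangentSpace J y) y ⟨z, v + w⟩).2 =
      (trivializationAt E' (fun y : N ↦ TangentSpace J y) y ⟨z, v⟩).2 +
        (trivializationAt E' (fun y : N ↦ TangentSpace J y) y ⟨z, w⟩).2 :=
  ((trivializationAt E' (fun y : N ↦ TangentSpace J y) y).linear ℝ hz).map_add v w

lemma trivializationAt_smul {y z : N} (c : ℝ) (v : TangentSpace J z)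
    (hz : z ∈ (trivializationAt E' (fun y : N ↦ TangentSpace J y) y).baseSet) :
    (trivializationAt E' (fun y : N ↦ TangentSpace J y) y ⟨z, c • v⟩).2 =
      c • (trivializationAt E' (fun y : N ↦ TangentSpace J y) y ⟨z, v⟩).2 :=
  ((trivializationAt E' (fun y : N ↦ TangentSpace J y) y).linear ℝ hz).map_smul c v

lemma symm_add {y z : N} (v w : E')
    (hz : z ∈ (trivializationAt E' (fun y : N ↦ TangentSpace J y) y).baseSet) :
    (trivializationAt E' (fun y : N ↦ TangentSpace J y) y).symm z (v + w) =
      (trivializationAt E' (fun y : N ↦ TangentSpace J y) y).symm z v +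
        (trivializationAt E' (fun y : N ↦ TangentSpace J y) y).symm z w := by
  have h (w : E') : (trivializationAt E' (fun y : N ↦ TangentSpace J y) y).symm z w =
      (trivializationAt E' (fun y : N ↦ TangentSpace J y) y).symmₗ ℝ z w :=
    (Trivialization.symmₗ_apply _ hz w).symm
  simp only [h]
  exact LinearMap.map_add _ v w

lemma symm_smul {y z : N} (c : ℝ) (w : E')
    (hz : z ∈ (trivializationAt E' (fun y : N ↦ TangentSpace J y) y).baseSet) :
    (trivializationAt E' (fun y : N ↦ TangentSpace J y) y).symm z (c • w) =
      c • (trivializationAt E' (fun y : N ↦ TangentSpace J y) y).symm z w := by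
  have h (w : E') : (trivializationAt E' (fun y : N ↦ TangentSpace J y) y).symm z w =
      (trivializationAt E' (fun y : N ↦ TangentSpace J y) y).symmₗ ℝ z w :=
    (Trivialization.symmₗ_apply _ hz w).symm
  simp only [h]
  exact LinearMap.map_smul _ c w

lemma extend_add {y : N} (v w : TangentSpace J y) :
    ∀ᶠ z in 𝓝 y, FiberBundle.extend E' (v + w) z =
      (FiberBundle.extend E' v + FiberBundle.extend E' w : Π z : N, TangentSpace J z) z := by
  filter_upwards [(Trivialization.open_baseSet _).mem_nhds
    (FiberBundle.mem_baseSet_trivializationAt E' (fun y : N ↦ TangentSpace J y) y)]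
    with z hz
  simp only [FiberBundle.extend, Pi.add_apply]
  rw [trivializationAt_add _ _
    (FiberBundle.mem_baseSet_trivializationAt E' (fun y : N ↦ TangentSpace J y) y)]
  exact symm_add _ _ hz

lemma extend_smul {y : N} (c : ℝ) (v : TangentSpace J y) :
    ∀ᶠ z in 𝓝 y, FiberBundle.extend E' (c • v) z =
      ((fun _ : N ↦ c) • FiberBundle.extend E' v : Π z : N, TangentSpace J z) z := by
  filter_upwards [(Trivialization.open_baseSet _).mem_nhds
    (FiberBundle.mem_baseSet_trivializationAt E' (fun y : N ↦ TangentSpace J y) y)]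
    with z hz
  simp only [FiberBundle.extend, Pi.smul_apply']
  rw [trivializationAt_smul _ _
    (FiberBundle.mem_baseSet_trivializationAt E' (fun y : N ↦ TangentSpace J y) y)]
  exact symm_smul _ _ hz

lemma symm_apply_self {y : N} (v : TangentSpace J y) :
    (trivializationAt E' (fun y : N ↦ TangentSpace J y) y).symm y
      (trivializationAt E' (fun y : N ↦ TangentSpace J y) y ⟨y, v⟩).2 = v :=
  FiberBundle.extend_apply_self ..

variable [IsContMDiffRiemannianBundle J ∞ E' (fun y : N ↦ TangentSpace J y)]

lemma leviCivita_extend_add {y : N} (v w u : TangentSpace J y) :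
    leviCivita J (FiberBundle.extend E' (v + w)) y u =
      leviCivita J (FiberBundle.extend E' v) y u + leviCivita J (FiberBundle.extend E' w) y u := by
  rw [leviCivita_congr (extend_add v w), leviCivita_add (FiberBundle.mdifferentiableAt_extend ..)
    (FiberBundle.mdifferentiableAt_extend ..)]

lemma leviCivita_extend_smul {y : N} (c : ℝ) (v u : TangentSpace J y) :
    leviCivita J (FiberBundle.extend E' (c • v)) y u =
      c • leviCivita J (FiberBundle.extend E' v) y u := by
  rw [leviCivita_congr (extend_smul c v), leviCivita_smul mdifferentiableAt_const
    (FiberBundle.mdifferentiableAt_extend ..)]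
  simp [mvfderiv_const]

/-- The Levi-Civita connection in the standard trivialization. -/
lemma leviCivita_eq_trivialization {Y : Π y : N, TangentSpace J y} {y : N}
    (hY : MDiffAt (T% Y) y) (v : TangentSpace J y) :
    leviCivita J Y y v =
      (trivializationAt E' (fun y : N ↦ TangentSpace J y) y).symm y
        (mvfderiv J (fun z ↦ (trivializationAt E' (fun y : N ↦ TangentSpace J y) y ⟨z, Y z⟩).2) y v)
      + leviCivita J (FiberBundle.extend E' (Y y)) y v := by
  set t := trivializationAt E' (fun y : N ↦ TangentSpace J y) y with ht
  have hbase : ∀ᶠ z in 𝓝 y, z ∈ t.baseSet := (Trivialization.open_baseSet _).mem_nhds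
    (FiberBundle.mem_baseSet_trivializationAt E' (fun y : N ↦ TangentSpace J y) _)
  have hb := FiberBundle.mem_baseSet_trivializationAt E' (fun y : N ↦ TangentSpace J y) y
  have hd {Y : Π y : N, TangentSpace J y} (hY : MDiffAt (T% Y) y) :
      MDifferentiableAt J 𝓘(ℝ, E') (fun z ↦ (t ⟨z, Y z⟩).2) y :=
    (mdifferentiableAt_section J (F := E') (E := fun y : N ↦ TangentSpace J y) Y).1 hY
  have hT : TensorialAt J E' (fun Y : Π y : N, TangentSpace J y ↦ leviCivita J Y y v -
      t.symm y (mvfderiv J (fun z ↦ (t ⟨z, Y z⟩).2) y v)) y := by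
    constructor
    · intro f Y hf hY
      rw [leviCivita_smul hf hY, mvfderiv_congr (f := fun z ↦ (t ⟨z, (f • Y) z⟩).2)
        (g := fun z ↦ f z • (t ⟨z, Y z⟩).2)
        (hbase.mono fun z hz ↦ trivializationAt_smul _ _ hz), mvfderiv_fun_smul hf (hd hY)]
      simp only [add_apply, smul_apply,
        ContinuousLinearMap.smulRight_apply, ht]
      rw [symm_add _ _ hb, symm_smul _ _ hb, symm_smul _ _ hb, symm_apply_self]
      module
    · intro Y Y' hY hY'
      rw [leviCivita_add hY hY', mvfderiv_congr (f := fun z ↦ (t ⟨z, (Y + Y') z⟩).2)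
        (g := fun z ↦ (t ⟨z, Y z⟩).2 + (t ⟨z, Y' z⟩).2)
        (hbase.mono fun z hz ↦ trivializationAt_add _ _ hz), mvfderiv_fun_add (hd hY) (hd hY')]
      simp only [add_apply, ht]
      rw [symm_add _ _ hb]
      module
  have h0 : mvfderiv J (fun z ↦ (t ⟨z, FiberBundle.extend E' (Y y) z⟩).2) y = 0 := by
    rw [mvfderiv_congr (g := fun _ ↦ (t ⟨y, Y y⟩).2), mvfderiv_const]
    filter_upwards [hbase] with z hz
    simp only [FiberBundle.extend]
    rw [← ht, t.apply_mk_symm hz]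
  have := hT.pointwise hY (FiberBundle.mdifferentiableAt_extend ..)
    (FiberBundle.extend_apply_self _ (Y y)).symm
  simp only [h0] at this
  rw [sub_eq_iff_eq_add] at this
  rw [this]
  have h1 : t.symm y (0 : E') = 0 := by
    simpa using symm_smul (0 : ℝ) (0 : E') hb
  simp [h1, add_comm]

lemma isConnectionAt_inducedConnection [IsManifold I ∞ M] (hφ : MDifferentiableAt I J φ x) :
    IsConnectionAt I x (fun V : Π z : M, TangentSpace J (φ z) ↦ MDiffAlongAt I J V x)
      (fun V ↦ inducedConnection I J φ V x) where
  zero_mem := by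
    rw [mdiffAlongAt_iff hφ]
    refine (mdifferentiableAt_const (c := (0 : E'))).congr_of_eventuallyEq ?_
    filter_upwards [eventually_mem_baseSet hφ] with z hz
    exact ((trivializationAt E' (fun y : N ↦ TangentSpace J y) (φ x)).linear ℝ hz).map_zero
  add_mem {s t} hs ht := by
    rw [mdiffAlongAt_iff hφ] at hs ht ⊢
    refine (hs.add ht).congr_of_eventuallyEq ?_
    filter_upwards [eventually_mem_baseSet hφ] with z hz
    exact trivializationAt_add _ _ hz
  smul_mem {f s} hf hs := by
    rw [mdiffAlongAt_iff hφ] at hs ⊢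
    refine (hf.smul hs).congr_of_eventuallyEq ?_
    filter_upwards [eventually_mem_baseSet hφ] with z hz
    exact trivializationAt_smul _ _ hz
  congr {s t} h := by
    funext u
    simp only [inducedConnection]
    rw [h.self_of_nhds, mvfderiv_congr]
    filter_upwards [h] with z hz
    rw [hz]
  map_add {s t} hs ht u := by
    have hb := FiberBundle.mem_baseSet_trivializationAt E' (fun y : N ↦ TangentSpace J y) (φ x)
    rw [mdiffAlongAt_iff hφ] at hs ht
    simp only [inducedConnection]
    rw [mvfderiv_congr (g := fun z ↦
      (trivializationAt E' (fun y : N ↦ TangentSpace J y) (φ x) ⟨φ z, s z⟩).2 +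
      (trivializationAt E' (fun y : N ↦ TangentSpace J y) (φ x) ⟨φ z, t z⟩).2),
      mvfderiv_fun_add hs ht, Pi.add_apply, leviCivita_extend_add, add_apply,
      symm_add _ _ hb]
    · abel
    · filter_upwards [eventually_mem_baseSet hφ] with z hz
      exact trivializationAt_add _ _ hz
  map_smul {f s} hf hs u := by
    have hb := FiberBundle.mem_baseSet_trivializationAt E' (fun y : N ↦ TangentSpace J y) (φ x)
    rw [mdiffAlongAt_iff hφ] at hs
    simp only [inducedConnection]
    rw [mvfderiv_congr (g := fun z ↦
      f z • (trivializationAt E' (fun y : N ↦ TangentSpace J y) (φ x) ⟨φ z, s z⟩).2),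
      mvfderiv_fun_smul hf hs, Pi.smul_apply', leviCivita_extend_smul]
    · simp only [add_apply, smul_apply,
        ContinuousLinearMap.smulRight_apply]
      rw [symm_add _ _ hb, symm_smul _ _ hb, symm_smul _ _ hb, symm_apply_self]
      module
    · filter_upwards [eventually_mem_baseSet hφ] with z hz
      exact trivializationAt_smul _ _ hz
  isLinearMap {s} hs := by
    have hb := FiberBundle.mem_baseSet_trivializationAt E' (fun y : N ↦ TangentSpace J y) (φ x)
    have h := leviCivita_isLinearMap (Y := FiberBundle.extend E' (s x)) (x := φ x)
      (FiberBundle.mdifferentiableAt_extend ..)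
    constructor
    · intro u v
      simp only [inducedConnection]
      rw [map_add, map_add, symm_add _ _ hb, h.map_add]
      abel
    · intro c u
      simp only [inducedConnection]
      rw [map_smul, map_smul, symm_smul _ _ hb, h.map_smul, smul_add]

lemma mdiffAlongAt_comp (hφ : MDifferentiableAt I J φ x) {Y : Π y : N, TangentSpace J y}
    (hY : MDiffAt (T% Y) (φ x)) : MDiffAlongAt I J (fun z ↦ Y (φ z)) x :=
  MDifferentiableAt.comp (I' := J) x hY hφ

/-- The induced connection on sections of the form `Y ∘ φ`. -/
lemma inducedConnection_comp [IsManifold I ∞ M] (hφ : MDifferentiableAt I J φ x)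
    {Y : Π y : N, TangentSpace J y} (hY : MDiffAt (T% Y) (φ x)) (u : TangentSpace I x) :
    inducedConnection I J φ (fun z ↦ Y (φ z)) x u =
      leviCivita J Y (φ x) (mfderiv I J φ x u) := by
  rw [leviCivita_eq_trivialization hY]
  simp only [inducedConnection]
  congr 2
  exact mfderiv_comp_apply x ((mdifferentiableAt_section J (F := E')
    (E := fun y : N ↦ TangentSpace J y) Y).1 hY) hφ u

end InducedConnection

lemma Orthonormal.sum_inner_smul_eq {V ι : Type*} [NormedAddCommGroup V] [InnerProductSpace ℝ V]
    [FiniteDimensional ℝ V] [Fintype ι] [Nonempty ι] {v : ι → V} (hv : Orthonormal ℝ v)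
    (hcard : Fintype.card ι = Module.finrank ℝ V) (w : V) :
    ∑ i, (inner ℝ (v i) w : ℝ) • v i = w := by
  let b := basisOfOrthonormalOfCardEqFinrank hv hcard
  have hb : ⇑b = v := coe_basisOfOrthonormalOfCardEqFinrank hv hcard
  let B := b.toOrthonormalBasis (by rw [hb]; exact hv)
  have hB : ⇑B = v := by simp [B, hb]
  simpa [hB] using B.sum_repr' w

section ConstantProducts

open Filter Topology

variable {E : Type*} [NormedAddCommGroup E] [NormedSpace ℝ E] [FiniteDimensional ℝ E]
  {H : Type*} [TopologicalSpace H] {I : ModelWithCorners ℝ E H}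
  {M : Type*} [TopologicalSpace M] [ChartedSpace H M] [IsManifold I ∞ M]
  [RiemannianBundle (fun x : M ↦ TangentSpace I x)]
  [IsContMDiffRiemannianBundle I ∞ E (fun x : M ↦ TangentSpace I x)]

/-- The Koszul formula for vector fields with constant scalar products. -/
lemma inner_leviCivita_of_const {X Y Z : Π x : M, TangentSpace I x} {x : M}
    (hX : MDiffAt (T% X) x) (hY : MDiffAt (T% Y) x) (hZ : MDiffAt (T% Z) x) {a b c : ℝ}
    (hYZ : ∀ᶠ z in 𝓝 x, inner ℝ (Y z) (Z z) = a) (hXZ : ∀ᶠ z in 𝓝 x, inner ℝ (X z) (Z z) = b)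
    (hXY : ∀ᶠ z in 𝓝 x, inner ℝ (X z) (Y z) = c) :
    inner ℝ (leviCivita I Y x (X x)) (Z x) = (1 / 2 : ℝ) *
      (inner ℝ (mlieBracket I X Y x) (Z x) - inner ℝ (mlieBracket I X Z x) (Y x)
        - inner ℝ (mlieBracket I Y Z x) (X x)) := by
  rw [inner_leviCivita hX hY hZ, koszul]
  simp only [dirDeriv]
  rw [mvfderiv_congr hYZ, mvfderiv_congr hXZ, mvfderiv_congr hXY]
  simp [mvfderiv_const]

end ConstantProducts

section SurfaceFrame

open Filter Topology

variable {N : Type*} [TopologicalSpace N] [ChartedSpace (EuclideanSpace ℝ (Fin 2)) N]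
  [IsManifold (𝓡 2) ∞ N] [RiemannianBundle (fun y : N ↦ TangentSpace (𝓡 2) y)]

/-- A smooth orthonormal frame on an open subset of a surface, with its structure functions. -/
structure IsSurfaceFrame (V : Set N) (ε₁ ε₂ : Π y : N, TangentSpace (𝓡 2) y) (F₁ F₂ : N → ℝ) :
    Prop where
  isOpen : IsOpen V
  smooth_ε₁ : ContMDiffOn (𝓡 2) (𝓡 2).tangent ∞ (fun y ↦ (⟨y, ε₁ y⟩ : TangentBundle (𝓡 2) N)) V
  smooth_ε₂ : ContMDiffOn (𝓡 2) (𝓡 2).tangent ∞ (fun y ↦ (⟨y, ε₂ y⟩ : TangentBundle (𝓡 2) N)) V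
  smooth_F₁ : ContMDiffOn (𝓡 2) 𝓘(ℝ, ℝ) ∞ F₁ V
  smooth_F₂ : ContMDiffOn (𝓡 2) 𝓘(ℝ, ℝ) ∞ F₂ V
  orthonormal : ∀ y ∈ V, Orthonormal ℝ ![ε₁ y, ε₂ y]
  bracket : ∀ y ∈ V, mlieBracket (𝓡 2) ε₁ ε₂ y = F₁ y • ε₁ y + F₂ y • ε₂ y

/-- The connection form `⟨∇ε₁, ε₂⟩` of an orthonormal frame of a surface. -/
def connectionForm (ε₁ ε₂ : Π y : N, TangentSpace (𝓡 2) y) (F₁ F₂ : N → ℝ) (y : N)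
    (v : TangentSpace (𝓡 2) y) : ℝ :=
  - F₁ y * inner ℝ (ε₁ y) v - F₂ y * inner ℝ (ε₂ y) v

namespace IsSurfaceFrame

variable {V : Set N} {ε₁ ε₂ : Π y : N, TangentSpace (𝓡 2) y} {F₁ F₂ : N → ℝ} {y : N}

lemma mem_nhds (h : IsSurfaceFrame V ε₁ ε₂ F₁ F₂) (hy : y ∈ V) : V ∈ 𝓝 y := h.isOpen.mem_nhds hy

lemma contMDiffAt_ε₁ (h : IsSurfaceFrame V ε₁ ε₂ F₁ F₂) (hy : y ∈ V) :
    ContMDiffAt (𝓡 2) (𝓡 2).tangent ∞ (T% ε₁) y := h.smooth_ε₁.contMDiffAt (h.mem_nhds hy)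

lemma contMDiffAt_ε₂ (h : IsSurfaceFrame V ε₁ ε₂ F₁ F₂) (hy : y ∈ V) :
    ContMDiffAt (𝓡 2) (𝓡 2).tangent ∞ (T% ε₂) y := h.smooth_ε₂.contMDiffAt (h.mem_nhds hy)

lemma mdiff_ε₁ (h : IsSurfaceFrame V ε₁ ε₂ F₁ F₂) (hy : y ∈ V) :
    MDifferentiableAt (𝓡 2) (𝓡 2).tangent (T% ε₁) y :=
  (h.contMDiffAt_ε₁ hy).mdifferentiableAt (by simp)

lemma mdiff_ε₂ (h : IsSurfaceFrame V ε₁ ε₂ F₁ F₂) (hy : y ∈ V) :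
    MDifferentiableAt (𝓡 2) (𝓡 2).tangent (T% ε₂) y :=
  (h.contMDiffAt_ε₂ hy).mdifferentiableAt (by simp)

lemma mdiff_F₁ (h : IsSurfaceFrame V ε₁ ε₂ F₁ F₂) (hy : y ∈ V) :
    MDifferentiableAt (𝓡 2) 𝓘(ℝ, ℝ) F₁ y :=
  (h.smooth_F₁.contMDiffAt (h.mem_nhds hy)).mdifferentiableAt (by simp)

lemma mdiff_F₂ (h : IsSurfaceFrame V ε₁ ε₂ F₁ F₂) (hy : y ∈ V) :
    MDifferentiableAt (𝓡 2) 𝓘(ℝ, ℝ) F₂ y :=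
  (h.smooth_F₂.contMDiffAt (h.mem_nhds hy)).mdifferentiableAt (by simp)

lemma inner₁₁ (h : IsSurfaceFrame V ε₁ ε₂ F₁ F₂) (hy : y ∈ V) :
    inner ℝ (ε₁ y) (ε₁ y) = (1 : ℝ) := by
  simpa using orthonormal_iff_ite.1 (h.orthonormal y hy) 0 0

lemma inner₂₂ (h : IsSurfaceFrame V ε₁ ε₂ F₁ F₂) (hy : y ∈ V) :
    inner ℝ (ε₂ y) (ε₂ y) = (1 : ℝ) := by
  simpa using orthonormal_iff_ite.1 (h.orthonormal y hy) 1 1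

lemma inner₁₂ (h : IsSurfaceFrame V ε₁ ε₂ F₁ F₂) (hy : y ∈ V) :
    inner ℝ (ε₁ y) (ε₂ y) = (0 : ℝ) := by
  simpa using orthonormal_iff_ite.1 (h.orthonormal y hy) 0 1

lemma inner₂₁ (h : IsSurfaceFrame V ε₁ ε₂ F₁ F₂) (hy : y ∈ V) :
    inner ℝ (ε₂ y) (ε₁ y) = (0 : ℝ) := by
  rw [real_inner_comm, h.inner₁₂ hy]

lemma expand (h : IsSurfaceFrame V ε₁ ε₂ F₁ F₂) (hy : y ∈ V) (v : TangentSpace (𝓡 2) y) :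
    (inner ℝ (ε₁ y) v : ℝ) • ε₁ y + (inner ℝ (ε₂ y) v : ℝ) • ε₂ y = v := by
  have hfin : Module.finrank ℝ (TangentSpace (𝓡 2) y) = 2 := finrank_euclideanSpace_fin
  simpa [Fin.sum_univ_two] using (h.orthonormal y hy).sum_inner_smul_eq (by simp [hfin]) v

lemma eq_of_inner (h : IsSurfaceFrame V ε₁ ε₂ F₁ F₂) (hy : y ∈ V) {v : TangentSpace (𝓡 2) y}
    {a b : ℝ} (ha : inner ℝ v (ε₁ y) = a) (hb : inner ℝ v (ε₂ y) = b) :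
    v = a • ε₁ y + b • ε₂ y := by
  rw [← h.expand hy v, real_inner_comm, ha, real_inner_comm, hb]

variable [IsContMDiffRiemannianBundle (𝓡 2) ∞ (EuclideanSpace ℝ (Fin 2))
      (fun y : N ↦ TangentSpace (𝓡 2) y)]

lemma leviCivita_frame (h : IsSurfaceFrame V ε₁ ε₂ F₁ F₂) (hy : y ∈ V) :
    leviCivita (𝓡 2) ε₁ y (ε₁ y) = - F₁ y • ε₂ y ∧ leviCivita (𝓡 2) ε₁ y (ε₂ y) = - F₂ y • ε₂ y ∧
    leviCivita (𝓡 2) ε₂ y (ε₁ y) = F₁ y • ε₁ y ∧ leviCivita (𝓡 2) ε₂ y (ε₂ y) = F₂ y • ε₁ y := by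
  have d₁ := h.mdiff_ε₁ hy
  have d₂ := h.mdiff_ε₂ hy
  have n₁₁ : ∀ᶠ z in 𝓝 y, inner ℝ (ε₁ z) (ε₁ z) = (1 : ℝ) :=
    mem_of_superset (h.mem_nhds hy) fun z hz ↦ h.inner₁₁ hz
  have n₂₂ : ∀ᶠ z in 𝓝 y, inner ℝ (ε₂ z) (ε₂ z) = (1 : ℝ) :=
    mem_of_superset (h.mem_nhds hy) fun z hz ↦ h.inner₂₂ hz
  have n₁₂ : ∀ᶠ z in 𝓝 y, inner ℝ (ε₁ z) (ε₂ z) = (0 : ℝ) :=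
    mem_of_superset (h.mem_nhds hy) fun z hz ↦ h.inner₁₂ hz
  have n₂₁ : ∀ᶠ z in 𝓝 y, inner ℝ (ε₂ z) (ε₁ z) = (0 : ℝ) :=
    mem_of_superset (h.mem_nhds hy) fun z hz ↦ h.inner₂₁ hz
  have b₁₂ := h.bracket y hy
  have b₂₁ : mlieBracket (𝓡 2) ε₂ ε₁ y = - (F₁ y • ε₁ y + F₂ y • ε₂ y) := by
    rw [mlieBracket_swap_apply, b₁₂]
  have hs (X : Π z : N, TangentSpace (𝓡 2) z) : mlieBracket (𝓡 2) X X y = 0 := by simp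
  have i₁₁ := h.inner₁₁ hy
  have i₂₂ := h.inner₂₂ hy
  have i₁₂ := h.inner₁₂ hy
  have i₂₁ := h.inner₂₁ hy
  refine ⟨?_, ?_, ?_, ?_⟩
  · rw [h.eq_of_inner hy (inner_leviCivita_of_const d₁ d₁ d₁ n₁₁ n₁₁ n₁₁)
      (inner_leviCivita_of_const d₁ d₁ d₂ n₁₂ n₁₂ n₁₁)]
    simp only [hs, b₁₂, inner_zero_left, inner_add_left, real_inner_smul_left, i₁₁, i₂₁]
    module
  · rw [h.eq_of_inner hy (inner_leviCivita_of_const d₂ d₁ d₁ n₁₁ n₂₁ n₂₁)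
      (inner_leviCivita_of_const d₂ d₁ d₂ n₁₂ n₂₂ n₂₁)]
    simp only [hs, b₁₂, b₂₁, inner_zero_left, inner_neg_left, inner_add_left, real_inner_smul_left,
      i₁₁, i₁₂, i₂₁, i₂₂]
    module
  · rw [h.eq_of_inner hy (inner_leviCivita_of_const d₁ d₂ d₁ n₂₁ n₁₁ n₁₂)
      (inner_leviCivita_of_const d₁ d₂ d₂ n₂₂ n₁₂ n₁₂)]
    simp only [hs, b₁₂, b₂₁, inner_zero_left, inner_neg_left, inner_add_left, real_inner_smul_left,
      i₁₁, i₁₂, i₂₁, i₂₂]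
    module
  · rw [h.eq_of_inner hy (inner_leviCivita_of_const d₂ d₂ d₁ n₂₁ n₂₁ n₂₂)
      (inner_leviCivita_of_const d₂ d₂ d₂ n₂₂ n₂₂ n₂₂)]
    simp only [hs, b₂₁, inner_zero_left, inner_neg_left, inner_add_left, real_inner_smul_left,
      i₁₂, i₂₂]
    module

lemma leviCivita_ε₁ (h : IsSurfaceFrame V ε₁ ε₂ F₁ F₂) (hy : y ∈ V) (v : TangentSpace (𝓡 2) y) :
    leviCivita (𝓡 2) ε₁ y v = connectionForm ε₁ ε₂ F₁ F₂ y v • ε₂ y := by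
  obtain ⟨h₁, h₂, -, -⟩ := h.leviCivita_frame hy
  have hl := leviCivita_isLinearMap (h.mdiff_ε₁ hy)
  conv_lhs => rw [← h.expand hy v]
  rw [hl.map_add, hl.map_smul, hl.map_smul, h₁, h₂, connectionForm]
  module

lemma leviCivita_ε₂ (h : IsSurfaceFrame V ε₁ ε₂ F₁ F₂) (hy : y ∈ V) (v : TangentSpace (𝓡 2) y) :
    leviCivita (𝓡 2) ε₂ y v = - connectionForm ε₁ ε₂ F₁ F₂ y v • ε₁ y := by
  obtain ⟨-, -, h₁, h₂⟩ := h.leviCivita_frame hy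
  have hl := leviCivita_isLinearMap (h.mdiff_ε₂ hy)
  conv_lhs => rw [← h.expand hy v]
  rw [hl.map_add, hl.map_smul, hl.map_smul, h₁, h₂, connectionForm]
  module

/-- The Levi-Civita connection in an orthonormal frame. -/
lemma leviCivita_eq (h : IsSurfaceFrame V ε₁ ε₂ F₁ F₂) (hy : y ∈ V)
    {Z : Π z : N, TangentSpace (𝓡 2) z} {a b : N → ℝ}
    (ha : MDifferentiableAt (𝓡 2) 𝓘(ℝ, ℝ) a y)
    (hb : MDifferentiableAt (𝓡 2) 𝓘(ℝ, ℝ) b y)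
    (hZ : ∀ᶠ z in 𝓝 y, Z z = a z • ε₁ z + b z • ε₂ z) (v : TangentSpace (𝓡 2) y) :
    leviCivita (𝓡 2) Z y v =
      (mvfderiv (𝓡 2) a y v - b y * connectionForm ε₁ ε₂ F₁ F₂ y v) • ε₁ y +
      (mvfderiv (𝓡 2) b y v + a y * connectionForm ε₁ ε₂ F₁ F₂ y v) • ε₂ y := by
  have hZ' : ∀ᶠ z in 𝓝 y, Z z = (a • ε₁ + b • ε₂) z := hZ
  rw [leviCivita_congr hZ', leviCivita_add (ha.smul_section (h.mdiff_ε₁ hy))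
    (hb.smul_section (h.mdiff_ε₂ hy)), leviCivita_smul ha (h.mdiff_ε₁ hy),
    leviCivita_smul hb (h.mdiff_ε₂ hy), h.leviCivita_ε₁ hy, h.leviCivita_ε₂ hy]
  module

lemma mdiff_connectionForm (h : IsSurfaceFrame V ε₁ ε₂ F₁ F₂) (hy : y ∈ V)
    {X : Π z : N, TangentSpace (𝓡 2) z} (hX : MDifferentiableAt (𝓡 2) (𝓡 2).tangent (T% X) y) :
    MDifferentiableAt (𝓡 2) 𝓘(ℝ, ℝ) (fun z ↦ connectionForm ε₁ ε₂ F₁ F₂ z (X z)) y := by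
  have h1 := (h.mdiff_F₁ hy).neg.mul (mdifferentiableAt_inner (h.mdiff_ε₁ hy) hX)
  have h2 := (h.mdiff_F₂ hy).mul (mdifferentiableAt_inner (h.mdiff_ε₂ hy) hX)
  exact h1.sub h2

end IsSurfaceFrame

end SurfaceFrame

section Curvature

open Filter Topology

variable {N : Type*} [TopologicalSpace N] [ChartedSpace (EuclideanSpace ℝ (Fin 2)) N]
  [IsManifold (𝓡 2) ∞ N] [RiemannianBundle (fun y : N ↦ TangentSpace (𝓡 2) y)]
  [IsContMDiffRiemannianBundle (𝓡 2) ∞ (EuclideanSpace ℝ (Fin 2))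
      (fun y : N ↦ TangentSpace (𝓡 2) y)]

/-- The exterior derivative of the connection form. -/
def connectionFormDeriv (ε₁ ε₂ : Π y : N, TangentSpace (𝓡 2) y) (F₁ F₂ : N → ℝ) (y : N)
    (X Y : Π z : N, TangentSpace (𝓡 2) z) : ℝ :=
  mvfderiv (𝓡 2) (fun z ↦ connectionForm ε₁ ε₂ F₁ F₂ z (Y z)) y (X y)
    - mvfderiv (𝓡 2) (fun z ↦ connectionForm ε₁ ε₂ F₁ F₂ z (X z)) y (Y y)
    - connectionForm ε₁ ε₂ F₁ F₂ y (mlieBracket (𝓡 2) X Y y)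

/-- The Gauss curvature in terms of the structure functions of an orthonormal frame. -/
def frameCurvature (ε₁ ε₂ : Π y : N, TangentSpace (𝓡 2) y) (F₁ F₂ : N → ℝ) (y : N) : ℝ :=
  mvfderiv (𝓡 2) F₂ y (ε₁ y) - mvfderiv (𝓡 2) F₁ y (ε₂ y) - F₁ y ^ 2 - F₂ y ^ 2

lemma connectionForm_add (ε₁ ε₂ : Π y : N, TangentSpace (𝓡 2) y) (F₁ F₂ : N → ℝ) (y : N)
    (v w : TangentSpace (𝓡 2) y) : connectionForm ε₁ ε₂ F₁ F₂ y (v + w) =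
      connectionForm ε₁ ε₂ F₁ F₂ y v + connectionForm ε₁ ε₂ F₁ F₂ y w := by
  simp only [connectionForm, inner_add_right]
  ring

lemma connectionForm_smul (ε₁ ε₂ : Π y : N, TangentSpace (𝓡 2) y) (F₁ F₂ : N → ℝ) (y : N)
    (c : ℝ) (v : TangentSpace (𝓡 2) y) : connectionForm ε₁ ε₂ F₁ F₂ y (c • v) =
      c * connectionForm ε₁ ε₂ F₁ F₂ y v := by
  simp only [connectionForm, real_inner_smul_right]
  ring

lemma connectionFormDeriv_swap (ε₁ ε₂ : Π y : N, TangentSpace (𝓡 2) y) (F₁ F₂ : N → ℝ) (y : N)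
    (X Y : Π z : N, TangentSpace (𝓡 2) z) :
    connectionFormDeriv ε₁ ε₂ F₁ F₂ y X Y = - connectionFormDeriv ε₁ ε₂ F₁ F₂ y Y X := by
  have h : mlieBracket (𝓡 2) X Y y = (-1 : ℝ) • mlieBracket (𝓡 2) Y X y := by
    rw [mlieBracket_swap_apply, neg_one_smul]
  rw [connectionFormDeriv, connectionFormDeriv, h, connectionForm_smul]
  ring

namespace IsSurfaceFrame

variable {V : Set N} {ε₁ ε₂ : Π y : N, TangentSpace (𝓡 2) y} {F₁ F₂ : N → ℝ} {y : N}

lemma tensorialAt_connectionFormDeriv (h : IsSurfaceFrame V ε₁ ε₂ F₁ F₂) (hy : y ∈ V)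
    (Y : Π z : N, TangentSpace (𝓡 2) z) :
    TensorialAt (𝓡 2) (EuclideanSpace ℝ (Fin 2))
      (fun X ↦ connectionFormDeriv ε₁ ε₂ F₁ F₂ y X Y) y where
  smul {f X} hf hX := by
    have h1 : (fun z ↦ connectionForm ε₁ ε₂ F₁ F₂ z ((f • X) z)) =
        f * fun z ↦ connectionForm ε₁ ε₂ F₁ F₂ z (X z) :=
      funext fun z ↦ connectionForm_smul _ _ _ _ _ _ _
    simp only [connectionFormDeriv]
    rw [h1, mvfderiv_mul hf (h.mdiff_connectionForm hy hX), mlieBracket_smul_left hf hX,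
      connectionForm_add, connectionForm_smul, connectionForm_smul]
    simp
    ring
  add {X X'} hX hX' := by
    have h1 : (fun z ↦ connectionForm ε₁ ε₂ F₁ F₂ z ((X + X') z)) =
        (fun z ↦ connectionForm ε₁ ε₂ F₁ F₂ z (X z)) +
          fun z ↦ connectionForm ε₁ ε₂ F₁ F₂ z (X' z) :=
      funext fun z ↦ connectionForm_add _ _ _ _ _ _ _
    simp only [connectionFormDeriv]
    rw [h1, mvfderiv_add (h.mdiff_connectionForm hy hX) (h.mdiff_connectionForm hy hX'),
      mlieBracket_add_left hX hX', connectionForm_add]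
    simp
    ring

lemma connectionFormDeriv_frame (h : IsSurfaceFrame V ε₁ ε₂ F₁ F₂) (hy : y ∈ V) :
    connectionFormDeriv ε₁ ε₂ F₁ F₂ y ε₁ ε₂ = - frameCurvature ε₁ ε₂ F₁ F₂ y := by
  have h₁ : (fun z ↦ connectionForm ε₁ ε₂ F₁ F₂ z (ε₁ z)) =ᶠ[𝓝 y] - F₁ := by
    filter_upwards [h.mem_nhds hy] with z hz
    simp only [connectionForm, h.inner₁₁ hz, h.inner₂₁ hz, Pi.neg_apply]
    ring
  have h₂ : (fun z ↦ connectionForm ε₁ ε₂ F₁ F₂ z (ε₂ z)) =ᶠ[𝓝 y] - F₂ := by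
    filter_upwards [h.mem_nhds hy] with z hz
    simp only [connectionForm, h.inner₂₂ hz, h.inner₁₂ hz, Pi.neg_apply]
    ring
  have h₁' : connectionForm ε₁ ε₂ F₁ F₂ y (ε₁ y) = (- F₁) y := h₁.self_of_nhds
  have h₂' : connectionForm ε₁ ε₂ F₁ F₂ y (ε₂ y) = (- F₂) y := h₂.self_of_nhds
  rw [connectionFormDeriv, mvfderiv_congr h₁, mvfderiv_congr h₂, h.bracket y hy,
    connectionForm_add, connectionForm_smul, connectionForm_smul, h₁',
    h₂', mvfderiv_neg, mvfderiv_neg, frameCurvature]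
  simp
  ring

lemma connectionFormDeriv_eq (h : IsSurfaceFrame V ε₁ ε₂ F₁ F₂) (hy : y ∈ V)
    {X Y : Π z : N, TangentSpace (𝓡 2) z}
    (hX : MDifferentiableAt (𝓡 2) (𝓡 2).tangent (T% X) y)
    (hY : MDifferentiableAt (𝓡 2) (𝓡 2).tangent (T% Y) y) :
    connectionFormDeriv ε₁ ε₂ F₁ F₂ y X Y = - frameCurvature ε₁ ε₂ F₁ F₂ y *
      (inner ℝ (ε₁ y) (X y) * inner ℝ (ε₂ y) (Y y) -
        inner ℝ (ε₂ y) (X y) * inner ℝ (ε₁ y) (Y y)) := by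
  have d₁ := h.mdiff_ε₁ hy
  have d₂ := h.mdiff_ε₂ hy
  have key {X : Π z : N, TangentSpace (𝓡 2) z}
      (hX : MDifferentiableAt (𝓡 2) (𝓡 2).tangent (T% X) y) (Y : Π z : N, TangentSpace (𝓡 2) z) :
      connectionFormDeriv ε₁ ε₂ F₁ F₂ y X Y =
        inner ℝ (ε₁ y) (X y) * connectionFormDeriv ε₁ ε₂ F₁ F₂ y ε₁ Y +
        inner ℝ (ε₂ y) (X y) * connectionFormDeriv ε₁ ε₂ F₁ F₂ y ε₂ Y := by
    have hT := h.tensorialAt_connectionFormDeriv hy Y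
    have c₁ : MDifferentiableAt (𝓡 2) 𝓘(ℝ, ℝ) (fun _ : N ↦ (inner ℝ (ε₁ y) (X y) : ℝ)) y :=
      mdifferentiableAt_const
    have c₂ : MDifferentiableAt (𝓡 2) 𝓘(ℝ, ℝ) (fun _ : N ↦ (inner ℝ (ε₂ y) (X y) : ℝ)) y :=
      mdifferentiableAt_const
    have e₁ := hT.smul c₁ d₁
    have e₂ := hT.smul c₂ d₂
    have e := hT.add (c₁.smul_section d₁) (c₂.smul_section d₂)
    rw [e₁, e₂] at e
    simp only [smul_eq_mul] at e
    rw [← e]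
    exact hT.pointwise hX (mdifferentiableAt_add_section (c₁.smul_section d₁)
      (c₂.smul_section d₂)) (h.expand hy (X y)).symm
  have hself (X : Π z : N, TangentSpace (𝓡 2) z) :
      connectionFormDeriv ε₁ ε₂ F₁ F₂ y X X = 0 := by
    linarith [connectionFormDeriv_swap ε₁ ε₂ F₁ F₂ y X X]
  rw [key hX, connectionFormDeriv_swap _ _ _ _ _ ε₁, connectionFormDeriv_swap _ _ _ _ _ ε₂,
    key hY ε₁, key hY ε₂, hself, hself, connectionFormDeriv_swap _ _ _ _ _ ε₂,
    h.connectionFormDeriv_frame hy]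
  ring

/-- The curvature tensor of a surface. -/
lemma riemannCurvature_eq (h : IsSurfaceFrame V ε₁ ε₂ F₁ F₂) (hy : y ∈ V)
    (u w z : TangentSpace (𝓡 2) y) :
    riemannCurvature (𝓡 2) y u w z = (frameCurvature ε₁ ε₂ F₁ F₂ y *
      (inner ℝ (ε₁ y) u * inner ℝ (ε₂ y) w - inner ℝ (ε₂ y) u * inner ℝ (ε₁ y) w)) •
      ((inner ℝ (ε₂ y) z : ℝ) • ε₁ y - (inner ℝ (ε₁ y) z : ℝ) • ε₂ y) := by
  let U : Π z : N, TangentSpace (𝓡 2) z := FiberBundle.extend (EuclideanSpace ℝ (Fin 2)) u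
  let W : Π z : N, TangentSpace (𝓡 2) z := FiberBundle.extend (EuclideanSpace ℝ (Fin 2)) w
  let Z : Π z : N, TangentSpace (𝓡 2) z := FiberBundle.extend (EuclideanSpace ℝ (Fin 2)) z
  have hUy : U y = u := FiberBundle.extend_apply_self ..
  have hWy : W y = w := FiberBundle.extend_apply_self ..
  have hZy : Z y = z := FiberBundle.extend_apply_self ..
  have hsm (v : TangentSpace (𝓡 2) y) : ContMDiffAt (𝓡 2) (𝓡 2).tangent 2
      (T% (FiberBundle.extend (EuclideanSpace ℝ (Fin 2)) v)) y := by
    have : ContMDiffVectorBundle 2 (EuclideanSpace ℝ (Fin 2))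
      (TangentSpace (𝓡 2) : N → Type _) (𝓡 2) := inferInstance
    exact FiberBundle.contMDiffAt_extend ..
  have hU : ContMDiffAt (𝓡 2) (𝓡 2).tangent 2 (T% U) y := hsm u
  have hW : ContMDiffAt (𝓡 2) (𝓡 2).tangent 2 (T% W) y := hsm w
  have hZ : ContMDiffAt (𝓡 2) (𝓡 2).tangent 2 (T% Z) y := hsm z
  have hle : (2 : WithTop ℕ∞) ≤ ∞ := ENat.LEInfty.out
  have : IsContMDiffRiemannianBundle (𝓡 2) 2 (EuclideanSpace ℝ (Fin 2))
    (fun y : N ↦ TangentSpace (𝓡 2) y) := IsContMDiffRiemannianBundle.of_le hle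
  let a (z' : N) : ℝ := inner ℝ (ε₁ z') (Z z')
  let b (z' : N) : ℝ := inner ℝ (ε₂ z') (Z z')
  let θ := connectionForm ε₁ ε₂ F₁ F₂
  have ha : ContMDiffAt (𝓡 2) 𝓘(ℝ, ℝ) 2 a y := ContMDiffAt.inner_bundle
    (F := EuclideanSpace ℝ (Fin 2)) (E := fun y : N ↦ TangentSpace (𝓡 2) y)
    ((h.contMDiffAt_ε₁ hy).of_le hle) hZ
  have hb : ContMDiffAt (𝓡 2) 𝓘(ℝ, ℝ) 2 b y := ContMDiffAt.inner_bundle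
    (F := EuclideanSpace ℝ (Fin 2)) (E := fun y : N ↦ TangentSpace (𝓡 2) y)
    ((h.contMDiffAt_ε₂ hy).of_le hle) hZ
  have hev := h.isOpen.eventually_mem hy
  have hexp : ∀ᶠ z' in 𝓝 y, Z z' = a z' • ε₁ z' + b z' • ε₂ z' :=
    hev.mono fun z' hz' ↦ (h.expand hz' (Z z')).symm
  have hcov (X : Π z : N, TangentSpace (𝓡 2) z) : ∀ᶠ z' in 𝓝 y, leviCivita (𝓡 2) Z z' (X z') =
      (dirDeriv (𝓡 2) X a - b * fun z ↦ θ z (X z)) z' • ε₁ z' +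
      (dirDeriv (𝓡 2) X b + a * fun z ↦ θ z (X z)) z' • ε₂ z' := by
    filter_upwards [hev, hexp.eventually_nhds,
      (contMDiffAt_iff_contMDiffAt_nhds (by simp)).1 ha,
      (contMDiffAt_iff_contMDiffAt_nhds (by simp)).1 hb] with z' hz' hexp' ha' hb'
    exact h.leviCivita_eq hz' (ha'.mdifferentiableAt two_ne_zero)
      (hb'.mdifferentiableAt two_ne_zero) hexp' _
  have ha1 := ha.mdifferentiableAt two_ne_zero
  have hb1 := hb.mdifferentiableAt two_ne_zero
  have hder {f : N → ℝ} {X : Π z : N, TangentSpace (𝓡 2) z}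
      (hf : ContMDiffAt (𝓡 2) 𝓘(ℝ, ℝ) 2 f y) (hX : ContMDiffAt (𝓡 2) (𝓡 2).tangent 2 (T% X) y) :
      MDifferentiableAt (𝓡 2) 𝓘(ℝ, ℝ) (dirDeriv (𝓡 2) X f) y := by
    have hf2 : ContMDiffAt (𝓡 2) 𝓘(ℝ, ℝ) ((1 : ℕ) + 1) f y := by
      convert hf using 1
      norm_num
    exact (contMDiffAt_dirDeriv (m := 1) hf2 (hX.of_le (by norm_num))).mdifferentiableAt one_ne_zero
  have hcov2 {X Y : Π z : N, TangentSpace (𝓡 2) z}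
      (hX : ContMDiffAt (𝓡 2) (𝓡 2).tangent 2 (T% X) y) :
      leviCivita (𝓡 2) (fun z' ↦ leviCivita (𝓡 2) Z z' (X z')) y (Y y) =
        (dirDeriv (𝓡 2) Y (dirDeriv (𝓡 2) X a) y
          - (b y * mvfderiv (𝓡 2) (fun z ↦ θ z (X z)) y (Y y) + θ y (X y) * dirDeriv (𝓡 2) Y b y)
          - (dirDeriv (𝓡 2) X b y + a y * θ y (X y)) * θ y (Y y)) • ε₁ y +
        (dirDeriv (𝓡 2) Y (dirDeriv (𝓡 2) X b) y
          + (a y * mvfderiv (𝓡 2) (fun z ↦ θ z (X z)) y (Y y) + θ y (X y) * dirDeriv (𝓡 2) Y a y)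
          + (dirDeriv (𝓡 2) X a y - b y * θ y (X y)) * θ y (Y y)) • ε₂ y := by
    have hθ := h.mdiff_connectionForm hy (hX.mdifferentiableAt two_ne_zero)
    rw [h.leviCivita_eq hy ((hder ha hX).sub (hb1.mul hθ)) ((hder hb hX).add (ha1.mul hθ)) (hcov X),
      mvfderiv_sub (hder ha hX) (hb1.mul hθ), mvfderiv_add (hder hb hX) (ha1.mul hθ),
      mvfderiv_mul hb1 hθ, mvfderiv_mul ha1 hθ]
    rfl
  have hΩ := h.connectionFormDeriv_eq hy (hU.mdifferentiableAt two_ne_zero)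
    (hW.mdifferentiableAt two_ne_zero)
  rw [hUy, hWy] at hΩ
  have hca : mvfderiv (𝓡 2) a y (mlieBracket (𝓡 2) U W y) = _ := dirDeriv_mlieBracket ha hU hW
  have hcb : mvfderiv (𝓡 2) b y (mlieBracket (𝓡 2) U W y) = _ := dirDeriv_mlieBracket hb hU hW
  have h1 : riemannCurvature (𝓡 2) y u w z =
      leviCivita (𝓡 2) (fun z' ↦ leviCivita (𝓡 2) Z z' (W z')) y (U y)
      - leviCivita (𝓡 2) (fun z' ↦ leviCivita (𝓡 2) Z z' (U z')) y (W y)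
      - leviCivita (𝓡 2) Z y (mlieBracket (𝓡 2) U W y) := by
    rw [hUy, hWy]
    rfl
  have h2 : riemannCurvature (𝓡 2) y u w z = connectionFormDeriv ε₁ ε₂ F₁ F₂ y U W •
      (a y • ε₂ y - b y • ε₁ y) := by
    rw [h1, hcov2 hW, hcov2 hU, h.leviCivita_eq hy ha1 hb1 hexp, hca, hcb, connectionFormDeriv]
    simp only [θ]
    module
  have hay : a y = inner ℝ (ε₁ y) z := by simp only [a, hZy]
  have hby : b y = inner ℝ (ε₂ y) z := by simp only [b, hZy]
  rw [h2, hΩ, hay, hby]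
  module

lemma gaussCurvature_eq (h : IsSurfaceFrame V ε₁ ε₂ F₁ F₂) (hy : y ∈ V) :
    gaussCurvature y = frameCurvature ε₁ ε₂ F₁ F₂ y := by
  simp only [gaussCurvature]
  set β : OrthonormalBasis (Fin 2) ℝ (TangentSpace (𝓡 2) y) := (tangentONB (𝓡 2) y).reindex _
  have expand (i j : Fin 2) : inner ℝ (β i) (β j) = (inner ℝ (ε₁ y) (β i) * inner ℝ (ε₁ y) (β j)
      + inner ℝ (ε₂ y) (β i) * inner ℝ (ε₂ y) (β j) : ℝ) := by
    conv_lhs => rw [← h.expand hy (β i)]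
    simp only [inner_add_left, real_inner_smul_left]
  have h₀₀ : inner ℝ (β 0) (β 0) = (1 : ℝ) := by simp
  have h₁₁ : inner ℝ (β 1) (β 1) = (1 : ℝ) := by simp
  have h₀₁ : inner ℝ (β 0) (β 1) = (0 : ℝ) := by simp [β.inner_eq_ite]
  rw [expand] at h₀₀ h₁₁ h₀₁
  rw [h.riemannCurvature_eq hy]
  simp only [real_inner_smul_left, inner_sub_left]
  set p : ℝ := inner ℝ (ε₁ y) (β 0)
  set q : ℝ := inner ℝ (ε₂ y) (β 0)
  set r : ℝ := inner ℝ (ε₁ y) (β 1)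
  set s : ℝ := inner ℝ (ε₂ y) (β 1)
  have hdet : (p * s - q * r) ^ 2 = 1 := by
    linear_combination (r * r + s * s) * h₀₀ + h₁₁ - (p * r + q * s) * h₀₁
  linear_combination frameCurvature ε₁ ε₂ F₁ F₂ y * hdet

end IsSurfaceFrame

end Curvature

section AdaptedFrames

open Filter Topology

variable {M : Type*} [TopologicalSpace M] [ChartedSpace (EuclideanSpace ℝ (Fin 3)) M]
  [IsManifold (𝓡 3) ∞ M] [RiemannianBundle (fun x : M ↦ TangentSpace (𝓡 3) x)]
  {N : Type*} [TopologicalSpace N] [ChartedSpace (EuclideanSpace ℝ (Fin 2)) N]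
  [IsManifold (𝓡 2) ∞ N] [RiemannianBundle (fun y : N ↦ TangentSpace (𝓡 2) y)]

/-- An adapted frame of a Riemannian submersion, with its integrability data. -/
structure IsAdaptedFrameWith (φ : M → N) (U : Set M) (V : Set N)
    (e₁ e₂ e₃ : Π x : M, TangentSpace (𝓡 3) x) (ε₁ ε₂ : Π y : N, TangentSpace (𝓡 2) y)
    (f₁ f₂ k₁ k₂ σ : M → ℝ) (F₁ F₂ : N → ℝ) : Prop where
  smooth : ContMDiff (𝓡 3) (𝓡 2) ∞ φ
  frame : IsAdaptedFrame φ U V e₁ e₂ e₃ ε₁ ε₂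
  data : IsIntegrabilityData φ U V e₁ e₂ e₃ ε₁ ε₂ f₁ f₂ k₁ k₂ σ
  surface : IsSurfaceFrame V ε₁ ε₂ F₁ F₂
  f₁_eq : ∀ x ∈ U, f₁ x = F₁ (φ x)
  f₂_eq : ∀ x ∈ U, f₂ x = F₂ (φ x)

lemma isConnectionAt_mvfderiv (x : M) :
    IsConnectionAt (𝓡 3) x (fun s : M → ℝ ↦ MDifferentiableAt (𝓡 3) 𝓘(ℝ, ℝ) s x)
      (fun s v ↦ mvfderiv (𝓡 3) s x v) where
  zero_mem := mdifferentiableAt_const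
  add_mem hs ht := hs.add ht
  smul_mem hf hs := hf.mul hs
  congr hst := by
    funext v
    exact congrArg (· v) (mvfderiv_congr hst)
  map_add hs ht v := by
    rw [mvfderiv_add hs ht]
    rfl
  map_smul {f s} hf hs v := by
    rw [smul_eq_mul, mvfderiv_mul hf hs, add_apply, smul_apply, smul_apply]
    simp only [smul_eq_mul]
    ring
  isLinearMap _ := ⟨map_add _, map_smul _⟩

namespace IsAdaptedFrameWith

variable {φ : M → N} {U : Set M} {V : Set N}
  {e₁ e₂ e₃ : Π x : M, TangentSpace (𝓡 3) x} {ε₁ ε₂ : Π y : N, TangentSpace (𝓡 2) y}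
  {f₁ f₂ k₁ k₂ σ : M → ℝ} {F₁ F₂ : N → ℝ} {x : M}

section

variable (h : IsAdaptedFrameWith φ U V e₁ e₂ e₃ ε₁ ε₂ f₁ f₂ k₁ k₂ σ F₁ F₂)
include h

lemma mem_nhds (hx : x ∈ U) : U ∈ 𝓝 x := h.frame.isOpen_source.mem_nhds hx

lemma mem_target (hx : x ∈ U) : φ x ∈ V := h.frame.mapsTo hx

lemma mdiff_φ (x : M) : MDifferentiableAt (𝓡 3) (𝓡 2) φ x := h.smooth.mdifferentiable (by simp) x

lemma mdiff (hx : x ∈ U) {u : M → ℝ} (hu : ContMDiffOn (𝓡 3) 𝓘(ℝ, ℝ) ∞ u U) :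
    MDifferentiableAt (𝓡 3) 𝓘(ℝ, ℝ) u x :=
  (hu.contMDiffAt (h.mem_nhds hx)).mdifferentiableAt (by simp)

lemma mdiff_e₁ (hx : x ∈ U) : MDifferentiableAt (𝓡 3) (𝓡 3).tangent (T% e₁) x :=
  (h.frame.smooth_e₁.contMDiffAt (h.mem_nhds hx)).mdifferentiableAt (by simp)

lemma mdiff_e₂ (hx : x ∈ U) : MDifferentiableAt (𝓡 3) (𝓡 3).tangent (T% e₂) x :=
  (h.frame.smooth_e₂.contMDiffAt (h.mem_nhds hx)).mdifferentiableAt (by simp)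

lemma mdiff_e₃ (hx : x ∈ U) : MDifferentiableAt (𝓡 3) (𝓡 3).tangent (T% e₃) x :=
  (h.frame.smooth_e₃.contMDiffAt (h.mem_nhds hx)).mdifferentiableAt (by simp)

lemma smooth_f₁ : ContMDiffOn (𝓡 3) 𝓘(ℝ, ℝ) ∞ f₁ U :=
  (h.surface.smooth_F₁.comp h.smooth.contMDiffOn h.frame.mapsTo).congr h.f₁_eq

lemma smooth_f₂ : ContMDiffOn (𝓡 3) 𝓘(ℝ, ℝ) ∞ f₂ U :=
  (h.surface.smooth_F₂.comp h.smooth.contMDiffOn h.frame.mapsTo).congr h.f₂_eq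

lemma smooth_dirDeriv₁ {u : M → ℝ} (hu : ContMDiffOn (𝓡 3) 𝓘(ℝ, ℝ) ∞ u U) :
    ContMDiffOn (𝓡 3) 𝓘(ℝ, ℝ) ∞ (dirDeriv (𝓡 3) e₁ u) U :=
  ContMDiffOn.dirDeriv h.frame.isOpen_source hu h.frame.smooth_e₁

lemma smooth_dirDeriv₂ {u : M → ℝ} (hu : ContMDiffOn (𝓡 3) 𝓘(ℝ, ℝ) ∞ u U) :
    ContMDiffOn (𝓡 3) 𝓘(ℝ, ℝ) ∞ (dirDeriv (𝓡 3) e₂ u) U :=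
  ContMDiffOn.dirDeriv h.frame.isOpen_source hu h.frame.smooth_e₂

lemma smooth_dirDeriv₃ {u : M → ℝ} (hu : ContMDiffOn (𝓡 3) 𝓘(ℝ, ℝ) ∞ u U) :
    ContMDiffOn (𝓡 3) 𝓘(ℝ, ℝ) ∞ (dirDeriv (𝓡 3) e₃ u) U :=
  ContMDiffOn.dirDeriv h.frame.isOpen_source hu h.frame.smooth_e₃

lemma inner₁₁ (hx : x ∈ U) : inner ℝ (e₁ x) (e₁ x) = (1 : ℝ) := by
  simpa using orthonormal_iff_ite.1 (h.frame.orthonormal_e x hx) 0 0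

lemma inner₂₂ (hx : x ∈ U) : inner ℝ (e₂ x) (e₂ x) = (1 : ℝ) := by
  simpa using orthonormal_iff_ite.1 (h.frame.orthonormal_e x hx) 1 1

lemma inner₃₃ (hx : x ∈ U) : inner ℝ (e₃ x) (e₃ x) = (1 : ℝ) := by
  simpa using orthonormal_iff_ite.1 (h.frame.orthonormal_e x hx) 2 2

lemma inner₁₂ (hx : x ∈ U) : inner ℝ (e₁ x) (e₂ x) = (0 : ℝ) := by
  simpa using orthonormal_iff_ite.1 (h.frame.orthonormal_e x hx) 0 1

lemma inner₂₁ (hx : x ∈ U) : inner ℝ (e₂ x) (e₁ x) = (0 : ℝ) := by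
  simpa using orthonormal_iff_ite.1 (h.frame.orthonormal_e x hx) 1 0

lemma inner₁₃ (hx : x ∈ U) : inner ℝ (e₁ x) (e₃ x) = (0 : ℝ) := by
  simpa using orthonormal_iff_ite.1 (h.frame.orthonormal_e x hx) 0 2

lemma inner₃₁ (hx : x ∈ U) : inner ℝ (e₃ x) (e₁ x) = (0 : ℝ) := by
  simpa using orthonormal_iff_ite.1 (h.frame.orthonormal_e x hx) 2 0

lemma inner₂₃ (hx : x ∈ U) : inner ℝ (e₂ x) (e₃ x) = (0 : ℝ) := by
  simpa using orthonormal_iff_ite.1 (h.frame.orthonormal_e x hx) 1 2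

lemma inner₃₂ (hx : x ∈ U) : inner ℝ (e₃ x) (e₂ x) = (0 : ℝ) := by
  simpa using orthonormal_iff_ite.1 (h.frame.orthonormal_e x hx) 2 1

lemma expand (hx : x ∈ U) (v : TangentSpace (𝓡 3) x) :
    (inner ℝ (e₁ x) v : ℝ) • e₁ x + (inner ℝ (e₂ x) v : ℝ) • e₂ x
      + (inner ℝ (e₃ x) v : ℝ) • e₃ x = v := by
  have hfin : Module.finrank ℝ (TangentSpace (𝓡 3) x) = 3 := finrank_euclideanSpace_fin
  simpa [Fin.sum_univ_three] using (h.frame.orthonormal_e x hx).sum_inner_smul_eq (by simp [hfin]) v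

lemma eq_of_inner (hx : x ∈ U) {v : TangentSpace (𝓡 3) x} {a b c : ℝ}
    (ha : inner ℝ v (e₁ x) = a) (hb : inner ℝ v (e₂ x) = b) (hc : inner ℝ v (e₃ x) = c) :
    v = a • e₁ x + b • e₂ x + c • e₃ x := by
  rw [← h.expand hx v, real_inner_comm, ha, real_inner_comm, hb, real_inner_comm, hc]

lemma mfderiv_eq (hx : x ∈ U) (v : TangentSpace (𝓡 3) x) :
    mfderiv (𝓡 3) (𝓡 2) φ x v =
      (inner ℝ (e₁ x) v : ℝ) • ε₁ (φ x) + (inner ℝ (e₂ x) v : ℝ) • ε₂ (φ x) := by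
  conv_lhs => rw [← h.expand hx v]
  rw [map_add, map_add, map_smul, map_smul, map_smul, h.frame.related₁ x hx, h.frame.related₂ x hx,
    h.frame.vertical x hx, smul_zero, add_zero]

end

variable [IsContMDiffRiemannianBundle (𝓡 3) ∞ (EuclideanSpace ℝ (Fin 3))
      (fun x : M ↦ TangentSpace (𝓡 3) x)]
  [IsContMDiffRiemannianBundle (𝓡 2) ∞ (EuclideanSpace ℝ (Fin 2))
      (fun y : N ↦ TangentSpace (𝓡 2) y)]
  (h : IsAdaptedFrameWith φ U V e₁ e₂ e₃ ε₁ ε₂ f₁ f₂ k₁ k₂ σ F₁ F₂)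
include h

/-- The connection form on images of tangent vectors. -/
lemma connectionForm_mfderiv (hx : x ∈ U) (v : TangentSpace (𝓡 3) x) :
    connectionForm ε₁ ε₂ F₁ F₂ (φ x) (mfderiv (𝓡 3) (𝓡 2) φ x v) =
      - f₁ x * inner ℝ (e₁ x) v - f₂ x * inner ℝ (e₂ x) v := by
  have hy := h.mem_target hx
  rw [h.mfderiv_eq hx, connectionForm_add, connectionForm_smul, connectionForm_smul, connectionForm,
    connectionForm, h.surface.inner₁₁ hy, h.surface.inner₁₂ hy, h.surface.inner₂₁ hy,
    h.surface.inner₂₂ hy, h.f₁_eq x hx, h.f₂_eq x hx]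
  ring

lemma gaussCurvature_eq (hx : x ∈ U) : gaussCurvature (φ x) =
    dirDeriv (𝓡 3) e₁ f₂ x - dirDeriv (𝓡 3) e₂ f₁ x - f₁ x ^ 2 - f₂ x ^ 2 := by
  have hy := h.mem_target hx
  have key {f : M → ℝ} {F : N → ℝ} (hfF : ∀ z ∈ U, f z = F (φ z))
      (hF : MDifferentiableAt (𝓡 2) 𝓘(ℝ, ℝ) F (φ x)) (v : TangentSpace (𝓡 3) x) :
      mvfderiv (𝓡 3) f x v = mvfderiv (𝓡 2) F (φ x) (mfderiv (𝓡 3) (𝓡 2) φ x v) := by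
    have hev : f =ᶠ[𝓝 x] F ∘ φ := mem_of_superset (h.mem_nhds hx) hfF
    rw [mvfderiv_congr hev, mvfderiv_comp_apply x hF (h.mdiff_φ x)]
  rw [h.surface.gaussCurvature_eq hy, frameCurvature, h.f₁_eq x hx, h.f₂_eq x hx, dirDeriv, dirDeriv,
    key h.f₁_eq (h.surface.mdiff_F₁ hy), key h.f₂_eq (h.surface.mdiff_F₂ hy),
    h.frame.related₁ x hx, h.frame.related₂ x hx]

lemma leviCivita_frame (hx : x ∈ U) :
    leviCivita (𝓡 3) e₁ x (e₁ x) = - f₁ x • e₂ x ∧ leviCivita (𝓡 3) e₂ x (e₂ x) = f₂ x • e₁ x ∧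
    leviCivita (𝓡 3) e₃ x (e₃ x) = k₁ x • e₁ x + k₂ x • e₂ x := by
  have d₁ := h.mdiff_e₁ hx
  have d₂ := h.mdiff_e₂ hx
  have d₃ := h.mdiff_e₃ hx
  have hU := h.mem_nhds hx
  have n₁₁ : ∀ᶠ z in 𝓝 x, inner ℝ (e₁ z) (e₁ z) = (1 : ℝ) :=
    mem_of_superset hU fun z hz ↦ h.inner₁₁ hz
  have n₂₂ : ∀ᶠ z in 𝓝 x, inner ℝ (e₂ z) (e₂ z) = (1 : ℝ) :=
    mem_of_superset hU fun z hz ↦ h.inner₂₂ hz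
  have n₃₃ : ∀ᶠ z in 𝓝 x, inner ℝ (e₃ z) (e₃ z) = (1 : ℝ) :=
    mem_of_superset hU fun z hz ↦ h.inner₃₃ hz
  have n₁₂ : ∀ᶠ z in 𝓝 x, inner ℝ (e₁ z) (e₂ z) = (0 : ℝ) :=
    mem_of_superset hU fun z hz ↦ h.inner₁₂ hz
  have n₂₁ : ∀ᶠ z in 𝓝 x, inner ℝ (e₂ z) (e₁ z) = (0 : ℝ) :=
    mem_of_superset hU fun z hz ↦ h.inner₂₁ hz
  have n₁₃ : ∀ᶠ z in 𝓝 x, inner ℝ (e₁ z) (e₃ z) = (0 : ℝ) :=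
    mem_of_superset hU fun z hz ↦ h.inner₁₃ hz
  have n₃₁ : ∀ᶠ z in 𝓝 x, inner ℝ (e₃ z) (e₁ z) = (0 : ℝ) :=
    mem_of_superset hU fun z hz ↦ h.inner₃₁ hz
  have n₂₃ : ∀ᶠ z in 𝓝 x, inner ℝ (e₂ z) (e₃ z) = (0 : ℝ) :=
    mem_of_superset hU fun z hz ↦ h.inner₂₃ hz
  have n₃₂ : ∀ᶠ z in 𝓝 x, inner ℝ (e₃ z) (e₂ z) = (0 : ℝ) :=
    mem_of_superset hU fun z hz ↦ h.inner₃₂ hz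
  have b₁₂ := h.data.bracket₁₂ x hx
  have b₁₃ := h.data.bracket₁₃ x hx
  have b₂₃ := h.data.bracket₂₃ x hx
  have b₂₁ : mlieBracket (𝓡 3) e₂ e₁ x = - (f₁ x • e₁ x + f₂ x • e₂ x - (2 * σ x) • e₃ x) := by
    rw [mlieBracket_swap_apply, b₁₂]
  have b₃₁ : mlieBracket (𝓡 3) e₃ e₁ x = - (k₁ x • e₃ x) := by rw [mlieBracket_swap_apply, b₁₃]
  have b₃₂ : mlieBracket (𝓡 3) e₃ e₂ x = - (k₂ x • e₃ x) := by rw [mlieBracket_swap_apply, b₂₃]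
  have hs (X : Π z : M, TangentSpace (𝓡 3) z) : mlieBracket (𝓡 3) X X x = 0 := by simp
  refine ⟨?_, ?_, ?_⟩
  · rw [h.eq_of_inner hx (inner_leviCivita_of_const d₁ d₁ d₁ n₁₁ n₁₁ n₁₁)
      (inner_leviCivita_of_const d₁ d₁ d₂ n₁₂ n₁₂ n₁₁)
      (inner_leviCivita_of_const d₁ d₁ d₃ n₁₃ n₁₃ n₁₁)]
    simp only [hs, b₁₂, b₁₃, inner_zero_left, inner_add_left, inner_sub_left,
      real_inner_smul_left, h.inner₁₁ hx, h.inner₂₁ hx, h.inner₃₁ hx]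
    module
  · rw [h.eq_of_inner hx (inner_leviCivita_of_const d₂ d₂ d₁ n₂₁ n₂₁ n₂₂)
      (inner_leviCivita_of_const d₂ d₂ d₂ n₂₂ n₂₂ n₂₂)
      (inner_leviCivita_of_const d₂ d₂ d₃ n₂₃ n₂₃ n₂₂)]
    simp only [hs, b₂₁, b₂₃, inner_zero_left, inner_neg_left, inner_add_left, inner_sub_left,
      real_inner_smul_left, h.inner₁₂ hx, h.inner₂₂ hx, h.inner₃₂ hx]
    module
  · rw [h.eq_of_inner hx (inner_leviCivita_of_const d₃ d₃ d₁ n₃₁ n₃₁ n₃₃)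
      (inner_leviCivita_of_const d₃ d₃ d₂ n₃₂ n₃₂ n₃₃)
      (inner_leviCivita_of_const d₃ d₃ d₃ n₃₃ n₃₃ n₃₃)]
    simp only [hs, b₃₁, b₃₂, inner_zero_left, inner_neg_left, real_inner_smul_left, h.inner₃₃ hx]
    module

/-- The trace of a covariant derivative in an adapted frame. -/
lemma trace_eq {W : M → Type*} [∀ z, AddCommGroup (W z)] [∀ z, Module ℝ (W z)]
    {P : (Π z, W z) → Prop} {D : (Π z, W z) → TangentSpace (𝓡 3) x → W x}
    (hD : IsConnectionAt (𝓡 3) x P D) {L : Π z : M, TangentSpace (𝓡 3) z → W z}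
    (hL : ∀ z ∈ U, IsLinearMap ℝ (L z)) (hx : x ∈ U) (hL₁ : P (fun z ↦ L z (e₁ z)))
    (hL₂ : P (fun z ↦ L z (e₂ z))) (hL₃ : P (fun z ↦ L z (e₃ z))) :
    ∑ a, (D (fun z ↦ L z (FiberBundle.extend (EuclideanSpace ℝ (Fin 3)) (tangentONB (𝓡 3) x a) z))
          (FiberBundle.extend (EuclideanSpace ℝ (Fin 3)) (tangentONB (𝓡 3) x a) x)
        - L x (leviCivita (𝓡 3)
          (FiberBundle.extend (EuclideanSpace ℝ (Fin 3)) (tangentONB (𝓡 3) x a)) x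
          (FiberBundle.extend (EuclideanSpace ℝ (Fin 3)) (tangentONB (𝓡 3) x a) x))) =
      D (fun z ↦ L z (e₁ z)) (e₁ x) + D (fun z ↦ L z (e₂ z)) (e₂ x) + D (fun z ↦ L z (e₃ z)) (e₃ x)
        - (f₂ x + k₁ x) • L x (e₁ x) - (k₂ x - f₁ x) • L x (e₂ x) := by
  have hev := h.frame.isOpen_source.eventually_mem hx
  obtain ⟨l₁, l₂, l₃⟩ := h.leviCivita_frame hx
  have hlx := hL x hx
  rw [trace_covariant_derivative hD (hev.mono hL) (e := ![e₁, e₂, e₃])]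
  · rw [Fin.sum_univ_three]
    change D (fun z ↦ L z (e₁ z)) (e₁ x) - L x (leviCivita (𝓡 3) e₁ x (e₁ x)) +
      (D (fun z ↦ L z (e₂ z)) (e₂ x) - L x (leviCivita (𝓡 3) e₂ x (e₂ x))) +
      (D (fun z ↦ L z (e₃ z)) (e₃ x) - L x (leviCivita (𝓡 3) e₃ x (e₃ x))) = _
    rw [l₁, l₂, l₃, hlx.map_add, hlx.map_smul, hlx.map_smul, hlx.map_smul, hlx.map_smul]
    module
  · intro i
    fin_cases i
    exacts [h.mdiff_e₁ hx, h.mdiff_e₂ hx, h.mdiff_e₃ hx]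
  · filter_upwards [hev] with z hz v
    rw [Fin.sum_univ_three]
    exact h.expand hz v
  · intro i
    fin_cases i
    exacts [hL₁, hL₂, hL₃]

/-- The Laplacian of functions in an adapted frame. -/
lemma laplaceBeltrami_eq {u : M → ℝ} (hu : ContMDiffOn (𝓡 3) 𝓘(ℝ, ℝ) ∞ u U) (hx : x ∈ U) :
    laplaceBeltrami (𝓡 3) u x =
      dirDeriv (𝓡 3) e₁ (dirDeriv (𝓡 3) e₁ u) x + dirDeriv (𝓡 3) e₂ (dirDeriv (𝓡 3) e₂ u) x
        + dirDeriv (𝓡 3) e₃ (dirDeriv (𝓡 3) e₃ u) x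
        + f₁ x * dirDeriv (𝓡 3) e₂ u x - f₂ x * dirDeriv (𝓡 3) e₁ u x
        - k₁ x * dirDeriv (𝓡 3) e₁ u x - k₂ x * dirDeriv (𝓡 3) e₂ u x := by
  have hc : IsConnectionAt (𝓡 3) x (fun s : M → ℝ ↦ MDifferentiableAt (𝓡 3) 𝓘(ℝ, ℝ) s x)
      (fun s v ↦ mvfderiv (𝓡 3) s x v) := isConnectionAt_mvfderiv x
  refine (h.trace_eq (W := fun _ ↦ ℝ) hc (L := fun z v ↦ mvfderiv (𝓡 3) u z v)
    (fun z _ ↦ ⟨map_add _, map_smul _⟩) hx (h.mdiff hx (h.smooth_dirDeriv₁ hu))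
    (h.mdiff hx (h.smooth_dirDeriv₂ hu)) (h.mdiff hx (h.smooth_dirDeriv₃ hu))).trans ?_
  change dirDeriv (𝓡 3) e₁ (dirDeriv (𝓡 3) e₁ u) x + dirDeriv (𝓡 3) e₂ (dirDeriv (𝓡 3) e₂ u) x
      + dirDeriv (𝓡 3) e₃ (dirDeriv (𝓡 3) e₃ u) x - (f₂ x + k₁ x) * dirDeriv (𝓡 3) e₁ u x
      - (k₂ x - f₁ x) * dirDeriv (𝓡 3) e₂ u x = _
  ring

lemma smooth_laplaceBeltrami {u : M → ℝ} (hu : ContMDiffOn (𝓡 3) 𝓘(ℝ, ℝ) ∞ u U) :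
    ContMDiffOn (𝓡 3) 𝓘(ℝ, ℝ) ∞ (laplaceBeltrami (𝓡 3) u) U := by
  have h₁ := h.smooth_dirDeriv₁ hu
  have h₂ := h.smooth_dirDeriv₂ hu
  have h₁₁ := h.smooth_dirDeriv₁ h₁
  have h₂₂ := h.smooth_dirDeriv₂ h₂
  have h₃₃ := h.smooth_dirDeriv₃ (h.smooth_dirDeriv₃ hu)
  exact ((((((h₁₁.add h₂₂).add h₃₃).add (h.smooth_f₁.mul h₂)).sub (h.smooth_f₂.mul h₁)).sub
    (h.data.smooth_k₁.mul h₁)).sub (h.data.smooth_k₂.mul h₂)).congr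
    fun x hx ↦ h.laplaceBeltrami_eq hu hx

end IsAdaptedFrameWith

end AdaptedFrames

section AlongSubmersion

open Filter Topology

variable {M : Type*} [TopologicalSpace M] [ChartedSpace (EuclideanSpace ℝ (Fin 3)) M]
  [IsManifold (𝓡 3) ∞ M] [RiemannianBundle (fun x : M ↦ TangentSpace (𝓡 3) x)]
  [IsContMDiffRiemannianBundle (𝓡 3) ∞ (EuclideanSpace ℝ (Fin 3))
      (fun x : M ↦ TangentSpace (𝓡 3) x)]
  {N : Type*} [TopologicalSpace N] [ChartedSpace (EuclideanSpace ℝ (Fin 2)) N]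
  [IsManifold (𝓡 2) ∞ N] [RiemannianBundle (fun y : N ↦ TangentSpace (𝓡 2) y)]
  [IsContMDiffRiemannianBundle (𝓡 2) ∞ (EuclideanSpace ℝ (Fin 2))
      (fun y : N ↦ TangentSpace (𝓡 2) y)]

namespace IsAdaptedFrameWith

variable {φ : M → N} {U : Set M} {V : Set N}
  {e₁ e₂ e₃ : Π x : M, TangentSpace (𝓡 3) x} {ε₁ ε₂ : Π y : N, TangentSpace (𝓡 2) y}
  {f₁ f₂ k₁ k₂ σ : M → ℝ} {F₁ F₂ : N → ℝ} {x : M}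
  (h : IsAdaptedFrameWith φ U V e₁ e₂ e₃ ε₁ ε₂ f₁ f₂ k₁ k₂ σ F₁ F₂)
include h

lemma mdiffAlongAt {W : Π z : M, TangentSpace (𝓡 2) (φ z)} {a b : M → ℝ} (hx : x ∈ U)
    (ha : MDifferentiableAt (𝓡 3) 𝓘(ℝ, ℝ) a x) (hb : MDifferentiableAt (𝓡 3) 𝓘(ℝ, ℝ) b x)
    (hW : ∀ z ∈ U, W z = a z • ε₁ (φ z) + b z • ε₂ (φ z)) :
    MDiffAlongAt (𝓡 3) (𝓡 2) W x := by
  have hy := h.mem_target hx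
  have hc := isConnectionAt_inducedConnection (I := 𝓡 3) (J := 𝓡 2) (h.mdiff_φ x)
  have key := hc.add_mem
    (hc.smul_mem ha (mdiffAlongAt_comp (h.mdiff_φ x) (h.surface.mdiff_ε₁ hy)))
    (hc.smul_mem hb (mdiffAlongAt_comp (h.mdiff_φ x) (h.surface.mdiff_ε₂ hy)))
  refine MDifferentiableAt.congr_of_eventuallyEq key ?_
  filter_upwards [h.mem_nhds hx] with z hz
  rw [hW z hz]
  rfl

lemma inducedConnection_eq {W : Π z : M, TangentSpace (𝓡 2) (φ z)} {a b : M → ℝ} (hx : x ∈ U)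
    (ha : MDifferentiableAt (𝓡 3) 𝓘(ℝ, ℝ) a x) (hb : MDifferentiableAt (𝓡 3) 𝓘(ℝ, ℝ) b x)
    (hW : ∀ z ∈ U, W z = a z • ε₁ (φ z) + b z • ε₂ (φ z)) (u : TangentSpace (𝓡 3) x) :
    inducedConnection (𝓡 3) (𝓡 2) φ W x u =
      (mvfderiv (𝓡 3) a x u + b x * (f₁ x * inner ℝ (e₁ x) u + f₂ x * inner ℝ (e₂ x) u)) • ε₁ (φ x)
      + (mvfderiv (𝓡 3) b x u - a x * (f₁ x * inner ℝ (e₁ x) u + f₂ x * inner ℝ (e₂ x) u)) •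
        ε₂ (φ x) := by
  have hy := h.mem_target hx
  have hc := isConnectionAt_inducedConnection (I := 𝓡 3) (J := 𝓡 2) (h.mdiff_φ x)
  have m₁ := mdiffAlongAt_comp (h.mdiff_φ x) (h.surface.mdiff_ε₁ hy)
  have m₂ := mdiffAlongAt_comp (h.mdiff_φ x) (h.surface.mdiff_ε₂ hy)
  have hev : ∀ᶠ z in 𝓝 x, W z = (a • (fun z ↦ ε₁ (φ z)) + b • (fun z ↦ ε₂ (φ z))) z :=
    mem_of_superset (h.mem_nhds hx) hW
  have e := congrFun (hc.congr hev) u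
  refine e.trans ?_
  rw [hc.map_add (hc.smul_mem ha m₁) (hc.smul_mem hb m₂), hc.map_smul ha m₁, hc.map_smul hb m₂,
    inducedConnection_comp (h.mdiff_φ x) (h.surface.mdiff_ε₁ hy),
    inducedConnection_comp (h.mdiff_φ x) (h.surface.mdiff_ε₂ hy),
    h.surface.leviCivita_ε₁ hy, h.surface.leviCivita_ε₂ hy, h.connectionForm_mfderiv hx]
  module

lemma inducedConnection_e₁ {W : Π z : M, TangentSpace (𝓡 2) (φ z)} {a b : M → ℝ} (hx : x ∈ U)
    (ha : MDifferentiableAt (𝓡 3) 𝓘(ℝ, ℝ) a x) (hb : MDifferentiableAt (𝓡 3) 𝓘(ℝ, ℝ) b x)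
    (hW : ∀ z ∈ U, W z = a z • ε₁ (φ z) + b z • ε₂ (φ z)) :
    inducedConnection (𝓡 3) (𝓡 2) φ W x (e₁ x) =
      (dirDeriv (𝓡 3) e₁ a x + b x * f₁ x) • ε₁ (φ x)
        + (dirDeriv (𝓡 3) e₁ b x - a x * f₁ x) • ε₂ (φ x) := by
  rw [h.inducedConnection_eq hx ha hb hW, h.inner₁₁ hx, h.inner₂₁ hx, mul_one, mul_zero, add_zero]
  rfl

lemma inducedConnection_e₂ {W : Π z : M, TangentSpace (𝓡 2) (φ z)} {a b : M → ℝ} (hx : x ∈ U)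
    (ha : MDifferentiableAt (𝓡 3) 𝓘(ℝ, ℝ) a x) (hb : MDifferentiableAt (𝓡 3) 𝓘(ℝ, ℝ) b x)
    (hW : ∀ z ∈ U, W z = a z • ε₁ (φ z) + b z • ε₂ (φ z)) :
    inducedConnection (𝓡 3) (𝓡 2) φ W x (e₂ x) =
      (dirDeriv (𝓡 3) e₂ a x + b x * f₂ x) • ε₁ (φ x)
        + (dirDeriv (𝓡 3) e₂ b x - a x * f₂ x) • ε₂ (φ x) := by
  rw [h.inducedConnection_eq hx ha hb hW, h.inner₁₂ hx, h.inner₂₂ hx, mul_one, mul_zero, zero_add]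
  rfl

lemma inducedConnection_e₃ {W : Π z : M, TangentSpace (𝓡 2) (φ z)} {a b : M → ℝ} (hx : x ∈ U)
    (ha : MDifferentiableAt (𝓡 3) 𝓘(ℝ, ℝ) a x) (hb : MDifferentiableAt (𝓡 3) 𝓘(ℝ, ℝ) b x)
    (hW : ∀ z ∈ U, W z = a z • ε₁ (φ z) + b z • ε₂ (φ z)) :
    inducedConnection (𝓡 3) (𝓡 2) φ W x (e₃ x) =
      dirDeriv (𝓡 3) e₃ a x • ε₁ (φ x) + dirDeriv (𝓡 3) e₃ b x • ε₂ (φ x) := by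
  rw [h.inducedConnection_eq hx ha hb hW, h.inner₁₃ hx, h.inner₂₃ hx, mul_zero, mul_zero, add_zero,
    mul_zero, mul_zero, add_zero, sub_zero]
  rfl

/-- The tension field in an adapted frame. -/
lemma tensionField_eq (hx : x ∈ U) :
    tensionField (𝓡 3) (𝓡 2) φ x = - k₁ x • ε₁ (φ x) - k₂ x • ε₂ (φ x) := by
  have c (r : ℝ) : MDifferentiableAt (𝓡 3) 𝓘(ℝ, ℝ) (fun _ : M ↦ r) x := mdifferentiableAt_const
  have h₁ (z) (hz : z ∈ U) : mfderiv (𝓡 3) (𝓡 2) φ z (e₁ z) =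
      (1 : ℝ) • ε₁ (φ z) + (0 : ℝ) • ε₂ (φ z) := by simp [h.frame.related₁ z hz]
  have h₂ (z) (hz : z ∈ U) : mfderiv (𝓡 3) (𝓡 2) φ z (e₂ z) =
      (0 : ℝ) • ε₁ (φ z) + (1 : ℝ) • ε₂ (φ z) := by simp [h.frame.related₂ z hz]
  have h₃ (z) (hz : z ∈ U) : mfderiv (𝓡 3) (𝓡 2) φ z (e₃ z) =
      (0 : ℝ) • ε₁ (φ z) + (0 : ℝ) • ε₂ (φ z) := by simp [h.frame.vertical z hz]
  have hd (X : Π z : M, TangentSpace (𝓡 3) z) (r : ℝ) : dirDeriv (𝓡 3) X (fun _ ↦ r) x = 0 := by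
    rw [dirDeriv, mvfderiv_const]
    rfl
  have hc := isConnectionAt_inducedConnection (I := 𝓡 3) (J := 𝓡 2) (h.mdiff_φ x)
  refine (h.trace_eq hc (L := fun z v ↦ mfderiv (𝓡 3) (𝓡 2) φ z v)
    (fun z _ ↦ ⟨map_add _, map_smul _⟩) hx (h.mdiffAlongAt hx (c 1) (c 0) h₁)
    (h.mdiffAlongAt hx (c 0) (c 1) h₂) (h.mdiffAlongAt hx (c 0) (c 0) h₃)).trans ?_
  rw [h.inducedConnection_e₁ hx (c 1) (c 0) h₁, h.inducedConnection_e₂ hx (c 0) (c 1) h₂,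
    h.inducedConnection_e₃ hx (c 0) (c 0) h₃, h₁ x hx, h₂ x hx]
  simp only [hd]
  module

/-- The rough Laplacian of a section of the pull-back bundle in an adapted frame. -/
lemma roughLaplacian_eq {W : Π z : M, TangentSpace (𝓡 2) (φ z)} {a b : M → ℝ} (hx : x ∈ U)
    (ha : ContMDiffOn (𝓡 3) 𝓘(ℝ, ℝ) ∞ a U) (hb : ContMDiffOn (𝓡 3) 𝓘(ℝ, ℝ) ∞ b U)
    (hW : ∀ z ∈ U, W z = a z • ε₁ (φ z) + b z • ε₂ (φ z)) :
    roughLaplacian (𝓡 3) (𝓡 2) φ W x =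
      (laplaceBeltrami (𝓡 3) a x
          + f₁ x * dirDeriv (𝓡 3) e₁ b x + dirDeriv (𝓡 3) e₁ (fun z ↦ b z * f₁ z) x
          + f₂ x * dirDeriv (𝓡 3) e₂ b x + dirDeriv (𝓡 3) e₂ (fun z ↦ b z * f₂ z) x
          - f₁ x * k₁ x * b x - k₂ x * f₂ x * b x - a x * (f₁ x ^ 2 + f₂ x ^ 2)) • ε₁ (φ x)
      + (laplaceBeltrami (𝓡 3) b x
          - f₁ x * dirDeriv (𝓡 3) e₁ a x - dirDeriv (𝓡 3) e₁ (fun z ↦ a z * f₁ z) x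
          - f₂ x * dirDeriv (𝓡 3) e₂ a x - dirDeriv (𝓡 3) e₂ (fun z ↦ a z * f₂ z) x
          + f₁ x * k₁ x * a x + f₂ x * k₂ x * a x - b x * (f₁ x ^ 2 + f₂ x ^ 2)) • ε₂ (φ x) := by
  have h₁ (z) (hz : z ∈ U) := h.inducedConnection_e₁ hz (h.mdiff hz ha) (h.mdiff hz hb) hW
  have h₂ (z) (hz : z ∈ U) := h.inducedConnection_e₂ hz (h.mdiff hz ha) (h.mdiff hz hb) hW
  have h₃ (z) (hz : z ∈ U) := h.inducedConnection_e₃ hz (h.mdiff hz ha) (h.mdiff hz hb) hW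
  have haf₁ := ha.mul h.smooth_f₁
  have haf₂ := ha.mul h.smooth_f₂
  have hbf₁ := hb.mul h.smooth_f₁
  have hbf₂ := hb.mul h.smooth_f₂
  have a₁ := h.mdiff hx ((h.smooth_dirDeriv₁ ha).add hbf₁)
  have b₁ : MDifferentiableAt (𝓡 3) 𝓘(ℝ, ℝ) (dirDeriv (𝓡 3) e₁ b - a * f₁) x :=
    h.mdiff hx ((h.smooth_dirDeriv₁ hb).sub haf₁)
  have a₂ := h.mdiff hx ((h.smooth_dirDeriv₂ ha).add hbf₂)
  have b₂ : MDifferentiableAt (𝓡 3) 𝓘(ℝ, ℝ) (dirDeriv (𝓡 3) e₂ b - a * f₂) x :=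
    h.mdiff hx ((h.smooth_dirDeriv₂ hb).sub haf₂)
  have a₃ := h.mdiff hx (h.smooth_dirDeriv₃ ha)
  have b₃ := h.mdiff hx (h.smooth_dirDeriv₃ hb)
  have hadd (X : Π z : M, TangentSpace (𝓡 3) z) {u v : M → ℝ}
      (hu : ContMDiffOn (𝓡 3) 𝓘(ℝ, ℝ) ∞ u U) (hv : ContMDiffOn (𝓡 3) 𝓘(ℝ, ℝ) ∞ v U) :
      dirDeriv (𝓡 3) X (u + v) x = dirDeriv (𝓡 3) X u x + dirDeriv (𝓡 3) X v x := by
    rw [dirDeriv, mvfderiv_add (h.mdiff hx hu) (h.mdiff hx hv)]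
    rfl
  have hsub (X : Π z : M, TangentSpace (𝓡 3) z) {u v : M → ℝ}
      (hu : ContMDiffOn (𝓡 3) 𝓘(ℝ, ℝ) ∞ u U) (hv : ContMDiffOn (𝓡 3) 𝓘(ℝ, ℝ) ∞ v U) :
      dirDeriv (𝓡 3) X (u - v) x = dirDeriv (𝓡 3) X u x - dirDeriv (𝓡 3) X v x := by
    rw [dirDeriv, mvfderiv_sub (h.mdiff hx hu) (h.mdiff hx hv)]
    rfl
  have hc := isConnectionAt_inducedConnection (I := 𝓡 3) (J := 𝓡 2) (h.mdiff_φ x)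
  refine (h.trace_eq hc (L := fun z v ↦ inducedConnection (𝓡 3) (𝓡 2) φ W z v)
    (fun z hz ↦ (isConnectionAt_inducedConnection (h.mdiff_φ z)).isLinearMap
      (h.mdiffAlongAt hz (h.mdiff hz ha) (h.mdiff hz hb) hW)) hx (h.mdiffAlongAt hx a₁ b₁ h₁)
    (h.mdiffAlongAt hx a₂ b₂ h₂) (h.mdiffAlongAt hx a₃ b₃ h₃)).trans ?_
  rw [h.inducedConnection_e₁ hx a₁ b₁ h₁, h.inducedConnection_e₂ hx a₂ b₂ h₂,
    h.inducedConnection_e₃ hx a₃ b₃ h₃, h₁ x hx, h₂ x hx, h.laplaceBeltrami_eq ha hx,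
    h.laplaceBeltrami_eq hb hx, hadd _ (h.smooth_dirDeriv₁ ha) hbf₁,
    hadd _ (h.smooth_dirDeriv₂ ha) hbf₂, hsub _ (h.smooth_dirDeriv₁ hb) haf₁,
    hsub _ (h.smooth_dirDeriv₂ hb) haf₂]
  simp only [Pi.add_apply, Pi.sub_apply, Pi.mul_apply]
  have m (u v : M → ℝ) : u * v = fun z ↦ u z * v z := rfl
  rw [m, m, m, m]
  module

end IsAdaptedFrameWith

end AlongSubmersion

section Negation

variable {E : Type*} [NormedAddCommGroup E] [NormedSpace ℝ E] [FiniteDimensional ℝ E]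
  {H : Type*} [TopologicalSpace H] {I : ModelWithCorners ℝ E H}
  {M : Type*} [TopologicalSpace M] [ChartedSpace H M] [IsManifold I ∞ M]
  [RiemannianBundle (fun x : M ↦ TangentSpace I x)]

lemma dirDeriv_neg (X : Π x : M, TangentSpace I x) (f : M → ℝ) :
    dirDeriv I X (-f) = -dirDeriv I X f := by
  funext x
  rw [dirDeriv, mvfderiv_neg]
  rfl

lemma laplaceBeltrami_neg (f : M → ℝ) (x : M) :
    laplaceBeltrami I (-f) x = -laplaceBeltrami I f x := by
  rw [laplaceBeltrami, laplaceBeltrami, ← Finset.sum_neg_distrib]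
  refine Finset.sum_congr rfl fun i _ ↦ ?_
  rw [dirDeriv_neg, dirDeriv_neg, mvfderiv_neg, Pi.neg_apply, neg_apply]
  ring

end Negation

section Tritension

open Filter Topology

variable {M : Type*} [TopologicalSpace M] [ChartedSpace (EuclideanSpace ℝ (Fin 3)) M]
  [IsManifold (𝓡 3) ∞ M] [RiemannianBundle (fun x : M ↦ TangentSpace (𝓡 3) x)]
  [IsContMDiffRiemannianBundle (𝓡 3) ∞ (EuclideanSpace ℝ (Fin 3))
      (fun x : M ↦ TangentSpace (𝓡 3) x)]
  {N : Type*} [TopologicalSpace N] [ChartedSpace (EuclideanSpace ℝ (Fin 2)) N]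
  [IsManifold (𝓡 2) ∞ N] [RiemannianBundle (fun y : N ↦ TangentSpace (𝓡 2) y)]
  [IsContMDiffRiemannianBundle (𝓡 2) ∞ (EuclideanSpace ℝ (Fin 2))
      (fun y : N ↦ TangentSpace (𝓡 2) y)]

namespace IsAdaptedFrameWith

variable {φ : M → N} {U : Set M} {V : Set N}
  {e₁ e₂ e₃ : Π x : M, TangentSpace (𝓡 3) x} {ε₁ ε₂ : Π y : N, TangentSpace (𝓡 2) y}
  {f₁ f₂ k₁ k₂ σ : M → ℝ} {F₁ F₂ : N → ℝ} {x : M}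
  (h : IsAdaptedFrameWith φ U V e₁ e₂ e₃ ε₁ ε₂ f₁ f₂ k₁ k₂ σ F₁ F₂)
include h

lemma inner_ε₁_mfderiv (hx : x ∈ U) (v : TangentSpace (𝓡 3) x) :
    inner ℝ (ε₁ (φ x)) (mfderiv (𝓡 3) (𝓡 2) φ x v) = (inner ℝ (e₁ x) v : ℝ) := by
  have hy := h.mem_target hx
  rw [h.mfderiv_eq hx, inner_add_right, real_inner_smul_right, real_inner_smul_right,
    h.surface.inner₁₁ hy, h.surface.inner₁₂ hy, mul_one, mul_zero, add_zero]

lemma inner_ε₂_mfderiv (hx : x ∈ U) (v : TangentSpace (𝓡 3) x) :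
    inner ℝ (ε₂ (φ x)) (mfderiv (𝓡 3) (𝓡 2) φ x v) = (inner ℝ (e₂ x) v : ℝ) := by
  have hy := h.mem_target hx
  rw [h.mfderiv_eq hx, inner_add_right, real_inner_smul_right, real_inner_smul_right,
    h.surface.inner₂₁ hy, h.surface.inner₂₂ hy, mul_one, mul_zero, zero_add]

lemma inner_ε₁_comb (hx : x ∈ U) (a b : ℝ) :
    inner ℝ (ε₁ (φ x)) (a • ε₁ (φ x) + b • ε₂ (φ x)) = a := by
  have hy := h.mem_target hx
  rw [inner_add_right, real_inner_smul_right, real_inner_smul_right,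
    h.surface.inner₁₁ hy, h.surface.inner₁₂ hy, mul_one, mul_zero, add_zero]

lemma inner_ε₂_comb (hx : x ∈ U) (a b : ℝ) :
    inner ℝ (ε₂ (φ x)) (a • ε₁ (φ x) + b • ε₂ (φ x)) = b := by
  have hy := h.mem_target hx
  rw [inner_add_right, real_inner_smul_right, real_inner_smul_right,
    h.surface.inner₂₁ hy, h.surface.inner₂₂ hy, mul_one, mul_zero, zero_add]

/-- A curvature trace: `v`, `w` depend on a tangent vector of `M` in such a way that the area form
of `N` is linear on them. -/
lemma sum_riemannCurvature (hx : x ∈ U) (S : TangentSpace (𝓡 3) x →ₗ[ℝ] ℝ)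
    {v w : TangentSpace (𝓡 3) x → TangentSpace (𝓡 2) (φ x)}
    (hS : ∀ u, inner ℝ (ε₁ (φ x)) (v u) * inner ℝ (ε₂ (φ x)) (w u)
      - inner ℝ (ε₂ (φ x)) (v u) * inner ℝ (ε₁ (φ x)) (w u) = S u) :
    ∑ i, riemannCurvature (𝓡 2) (φ x) (v (tangentONB (𝓡 3) x i)) (w (tangentONB (𝓡 3) x i))
        (mfderiv (𝓡 3) (𝓡 2) φ x (tangentONB (𝓡 3) x i)) =
      (gaussCurvature (φ x) * S (e₂ x)) • ε₁ (φ x)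
        + (- gaussCurvature (φ x) * S (e₁ x)) • ε₂ (φ x) := by
  have hy := h.mem_target hx
  have hsum (u : TangentSpace (𝓡 3) x) :
      ∑ i, S (tangentONB (𝓡 3) x i) * inner ℝ u (tangentONB (𝓡 3) x i) = S u := by
    conv_rhs => rw [← (tangentONB (𝓡 3) x).sum_repr' u, map_sum]
    refine Finset.sum_congr rfl fun i _ ↦ ?_
    rw [map_smul, smul_eq_mul, real_inner_comm, mul_comm]
  rw [← hsum (e₁ x), ← hsum (e₂ x), Finset.mul_sum, Finset.mul_sum, Finset.sum_smul,
    Finset.sum_smul, ← Finset.sum_add_distrib]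
  refine Finset.sum_congr rfl fun i _ ↦ ?_
  rw [h.surface.riemannCurvature_eq hy, hS, ← h.surface.gaussCurvature_eq hy,
    h.inner_ε₁_mfderiv hx, h.inner_ε₂_mfderiv hx]
  module

lemma jacobiOp_eq {W : Π z : M, TangentSpace (𝓡 2) (φ z)} {a b : M → ℝ} (hx : x ∈ U)
    (ha : ContMDiffOn (𝓡 3) 𝓘(ℝ, ℝ) ∞ a U) (hb : ContMDiffOn (𝓡 3) 𝓘(ℝ, ℝ) ∞ b U)
    (hW : ∀ z ∈ U, W z = a z • ε₁ (φ z) + b z • ε₂ (φ z)) :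
    jacobiOp (𝓡 3) (𝓡 2) φ W x =
      (laplaceBeltrami (𝓡 3) a x
          + f₁ x * dirDeriv (𝓡 3) e₁ b x + dirDeriv (𝓡 3) e₁ (fun z ↦ b z * f₁ z) x
          + f₂ x * dirDeriv (𝓡 3) e₂ b x + dirDeriv (𝓡 3) e₂ (fun z ↦ b z * f₂ z) x
          - f₁ x * k₁ x * b x - k₂ x * f₂ x * b x
          - a x * (gaussCurvature (φ x) + f₁ x ^ 2 + f₂ x ^ 2)) • ε₁ (φ x)
      + (laplaceBeltrami (𝓡 3) b x
          - f₁ x * dirDeriv (𝓡 3) e₁ a x - dirDeriv (𝓡 3) e₁ (fun z ↦ a z * f₁ z) x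
          - f₂ x * dirDeriv (𝓡 3) e₂ a x - dirDeriv (𝓡 3) e₂ (fun z ↦ a z * f₂ z) x
          + f₁ x * k₁ x * a x + f₂ x * k₂ x * a x
          - b x * (gaussCurvature (φ x) + f₁ x ^ 2 + f₂ x ^ 2)) • ε₂ (φ x) := by
  let S : TangentSpace (𝓡 3) x →ₗ[ℝ] ℝ :=
    { toFun u := a x * inner ℝ (e₂ x) u - b x * inner ℝ (e₁ x) u
      map_add' u v := by
        rw [inner_add_right, inner_add_right]
        ring
      map_smul' c u := by
        rw [real_inner_smul_right, real_inner_smul_right, RingHom.id_apply, smul_eq_mul]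
        ring }
  have hS (u : TangentSpace (𝓡 3) x) :
      S u = a x * inner ℝ (e₂ x) u - b x * inner ℝ (e₁ x) u := rfl
  have key := h.sum_riemannCurvature hx S (v := fun _ ↦ W x)
    (w := fun u ↦ mfderiv (𝓡 3) (𝓡 2) φ x u) (fun u ↦ by
      rw [hW x hx, h.inner_ε₁_comb hx, h.inner_ε₂_comb hx, h.inner_ε₁_mfderiv hx,
        h.inner_ε₂_mfderiv hx, hS])
  rw [jacobiOp, key, h.roughLaplacian_eq hx ha hb hW, hS, hS, h.inner₁₁ hx, h.inner₁₂ hx,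
    h.inner₂₁ hx, h.inner₂₂ hx]
  module

lemma tensionField_eq_comb : ∀ z ∈ U,
    tensionField (𝓡 3) (𝓡 2) φ z = (-k₁) z • ε₁ (φ z) + (-k₂) z • ε₂ (φ z) := fun z hz ↦ by
  rw [h.tensionField_eq hz, Pi.neg_apply, Pi.neg_apply, neg_smul (k₂ z), sub_eq_add_neg]

/-- The rough Laplacian of the tension field. -/
lemma roughLaplacian_tensionField (hx : x ∈ U) :
    roughLaplacian (𝓡 3) (𝓡 2) φ (tensionField (𝓡 3) (𝓡 2) φ) x =
      coeffA e₁ e₂ f₁ f₂ k₁ k₂ x • ε₁ (φ x) + coeffB e₁ e₂ f₁ f₂ k₁ k₂ x • ε₂ (φ x) := by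
  have m (u v : M → ℝ) : (fun z ↦ (-u) z * v z) = -(fun z ↦ u z * v z) := by
    funext z
    simp
  rw [h.roughLaplacian_eq (a := -k₁) (b := -k₂) hx h.data.smooth_k₁.neg h.data.smooth_k₂.neg
    h.tensionField_eq_comb, coeffA, coeffB, m, m, m, m]
  simp only [dirDeriv_neg, laplaceBeltrami_neg, Pi.neg_apply]
  module

lemma smooth_coeffA : ContMDiffOn (𝓡 3) 𝓘(ℝ, ℝ) ∞ (coeffA e₁ e₂ f₁ f₂ k₁ k₂) U := by
  have p₁ := h.data.smooth_k₁
  have p₂ := h.data.smooth_k₂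
  have q₁ := h.smooth_f₁
  have q₂ := h.smooth_f₂
  exact (((((((((h.smooth_laplaceBeltrami p₁).neg.sub (q₁.mul (h.smooth_dirDeriv₁ p₂))).sub
    (h.smooth_dirDeriv₁ (p₂.mul q₁))).sub (q₂.mul (h.smooth_dirDeriv₂ p₂))).sub
    (h.smooth_dirDeriv₂ (p₂.mul q₂))).add ((p₁.mul p₂).mul q₁)).add (q₂.mul (p₂.pow 2))).add
    (p₁.mul (q₁.pow 2))).add (p₁.mul (q₂.pow 2)))

lemma smooth_coeffB : ContMDiffOn (𝓡 3) 𝓘(ℝ, ℝ) ∞ (coeffB e₁ e₂ f₁ f₂ k₁ k₂) U := by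
  have p₁ := h.data.smooth_k₁
  have p₂ := h.data.smooth_k₂
  have q₁ := h.smooth_f₁
  have q₂ := h.smooth_f₂
  exact (((((((((h.smooth_laplaceBeltrami p₂).neg.add (q₁.mul (h.smooth_dirDeriv₁ p₁))).add
    (h.smooth_dirDeriv₁ (p₁.mul q₁))).add (q₂.mul (h.smooth_dirDeriv₂ p₁))).add
    (h.smooth_dirDeriv₂ (p₁.mul q₂))).sub ((p₁.mul p₂).mul q₂)).sub (q₁.mul (p₁.pow 2))).add
    (p₂.mul (q₁.pow 2))).add (p₂.mul (q₂.pow 2)))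

/-- The curvature term of the tritension field. -/
lemma sum_riemannCurvature_tensionField (hx : x ∈ U) :
    ∑ i, riemannCurvature (𝓡 2) (φ x)
        (inducedConnection (𝓡 3) (𝓡 2) φ (tensionField (𝓡 3) (𝓡 2) φ) x (tangentONB (𝓡 3) x i))
        (tensionField (𝓡 3) (𝓡 2) φ x) (mfderiv (𝓡 3) (𝓡 2) φ x (tangentONB (𝓡 3) x i)) =
      (- gaussCurvature (φ x) * (- dirDeriv (𝓡 3) e₂ k₁ x * k₂ x + dirDeriv (𝓡 3) e₂ k₂ x * k₁ x
            - k₁ x ^ 2 * f₂ x - k₂ x ^ 2 * f₂ x)) • ε₁ (φ x)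
      + (- gaussCurvature (φ x) * (dirDeriv (𝓡 3) e₁ k₁ x * k₂ x - dirDeriv (𝓡 3) e₁ k₂ x * k₁ x
            + f₁ x * k₂ x ^ 2 + f₁ x * k₁ x ^ 2)) • ε₂ (φ x) := by
  have hτ := h.tensionField_eq_comb
  have p₁ : MDifferentiableAt (𝓡 3) 𝓘(ℝ, ℝ) (-k₁) x := h.mdiff hx h.data.smooth_k₁.neg
  have p₂ : MDifferentiableAt (𝓡 3) 𝓘(ℝ, ℝ) (-k₂) x := h.mdiff hx h.data.smooth_k₂.neg
  have hD := (isConnectionAt_inducedConnection (I := 𝓡 3) (J := 𝓡 2) (h.mdiff_φ x)).isLinearMap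
    (h.mdiffAlongAt hx p₁ p₂ hτ)
  let D : TangentSpace (𝓡 3) x → TangentSpace (𝓡 2) (φ x) :=
    inducedConnection (𝓡 3) (𝓡 2) φ (tensionField (𝓡 3) (𝓡 2) φ) x
  let S : TangentSpace (𝓡 3) x →ₗ[ℝ] ℝ :=
    { toFun u := inner ℝ (ε₁ (φ x)) (D u) * (- k₂ x) - inner ℝ (ε₂ (φ x)) (D u) * (- k₁ x)
      map_add' u v := by
        simp only [D]
        rw [hD.map_add, inner_add_right, inner_add_right]
        ring
      map_smul' c u := by
        simp only [D]
        rw [hD.map_smul, real_inner_smul_right, real_inner_smul_right, RingHom.id_apply,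
          smul_eq_mul]
        ring }
  have hS (u : TangentSpace (𝓡 3) x) : S u =
      inner ℝ (ε₁ (φ x)) (D u) * (- k₂ x) - inner ℝ (ε₂ (φ x)) (D u) * (- k₁ x) := rfl
  have D₁ := h.inducedConnection_e₁ hx p₁ p₂ hτ
  have D₂ := h.inducedConnection_e₂ hx p₁ p₂ hτ
  have key := h.sum_riemannCurvature hx S (v := D) (w := fun _ ↦ tensionField (𝓡 3) (𝓡 2) φ x)
    (fun u ↦ by rw [hτ x hx, h.inner_ε₁_comb hx, h.inner_ε₂_comb hx, hS]; rfl)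
  refine key.trans ?_
  rw [hS, hS]
  simp only [D]
  rw [D₁, D₂, h.inner_ε₁_comb hx, h.inner_ε₂_comb hx, h.inner_ε₁_comb hx, h.inner_ε₂_comb hx]
  simp only [dirDeriv_neg, Pi.neg_apply]
  module

/-- The tritension field in an adapted frame. -/
lemma tritensionField_eq {A B : M → ℝ} (hA : A = coeffA e₁ e₂ f₁ f₂ k₁ k₂)
    (hB : B = coeffB e₁ e₂ f₁ f₂ k₁ k₂) (hx : x ∈ U) :
    tritensionField (𝓡 3) (𝓡 2) φ x =
      (laplaceBeltrami (𝓡 3) A x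
          + f₁ x * dirDeriv (𝓡 3) e₁ B x + dirDeriv (𝓡 3) e₁ (fun z ↦ B z * f₁ z) x
          + f₂ x * dirDeriv (𝓡 3) e₂ B x + dirDeriv (𝓡 3) e₂ (fun z ↦ B z * f₂ z) x
          - f₁ x * k₁ x * B x - k₂ x * f₂ x * B x
          - A x * (gaussCurvature (φ x) + f₁ x ^ 2 + f₂ x ^ 2)
          + gaussCurvature (φ x) * (- dirDeriv (𝓡 3) e₂ k₁ x * k₂ x + dirDeriv (𝓡 3) e₂ k₂ x * k₁ x
            - k₁ x ^ 2 * f₂ x - k₂ x ^ 2 * f₂ x)) • ε₁ (φ x)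
      + (laplaceBeltrami (𝓡 3) B x
          - f₁ x * dirDeriv (𝓡 3) e₁ A x - dirDeriv (𝓡 3) e₁ (fun z ↦ A z * f₁ z) x
          - f₂ x * dirDeriv (𝓡 3) e₂ A x - dirDeriv (𝓡 3) e₂ (fun z ↦ A z * f₂ z) x
          + f₁ x * k₁ x * A x + f₂ x * k₂ x * A x
          - B x * (gaussCurvature (φ x) + f₁ x ^ 2 + f₂ x ^ 2)
          + gaussCurvature (φ x) * (dirDeriv (𝓡 3) e₁ k₁ x * k₂ x - dirDeriv (𝓡 3) e₁ k₂ x * k₁ x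
            + f₁ x * k₂ x ^ 2 + f₁ x * k₁ x ^ 2)) • ε₂ (φ x) := by
  subst hA hB
  rw [tritensionField, h.sum_riemannCurvature_tensionField hx, h.jacobiOp_eq hx h.smooth_coeffA
    h.smooth_coeffB fun z hz ↦ h.roughLaplacian_tensionField hz]
  module

lemma comb_eq_zero_iff (hx : x ∈ U) {a b : ℝ} :
    a • ε₁ (φ x) + b • ε₂ (φ x) = 0 ↔ a = 0 ∧ b = 0 := by
  refine ⟨fun hab ↦ ⟨?_, ?_⟩, fun ⟨ha, hb⟩ ↦ by rw [ha, hb, zero_smul, zero_smul, add_zero]⟩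
  · rw [← h.inner_ε₁_comb hx a b, hab, inner_zero_right]
  · rw [← h.inner_ε₂_comb hx a b, hab, inner_zero_right]

end IsAdaptedFrameWith

end Tritension

end

theorem proposition3p1
    {M : Type*} [TopologicalSpace M] [T2Space M] [SecondCountableTopology M]
    [ChartedSpace (EuclideanSpace ℝ (Fin 3)) M] [IsManifold (𝓡 3) ∞ M]
    [RiemannianBundle (fun x : M ↦ TangentSpace (𝓡 3) x)]
    [IsContMDiffRiemannianBundle (𝓡 3) ∞ (EuclideanSpace ℝ (Fin 3))
      (fun x : M ↦ TangentSpace (𝓡 3) x)]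
    {N : Type*} [TopologicalSpace N] [T2Space N] [SecondCountableTopology N]
    [ChartedSpace (EuclideanSpace ℝ (Fin 2)) N] [IsManifold (𝓡 2) ∞ N]
    [RiemannianBundle (fun y : N ↦ TangentSpace (𝓡 2) y)]
    [IsContMDiffRiemannianBundle (𝓡 2) ∞ (EuclideanSpace ℝ (Fin 2))
      (fun y : N ↦ TangentSpace (𝓡 2) y)]
    (φ : M → N) (hφ : IsRiemannianSubmersion (𝓡 3) (𝓡 2) φ)
    (U : Set M) (V : Set N)
    (e₁ e₂ e₃ : Π x : M, TangentSpace (𝓡 3) x) (ε₁ ε₂ : Π y : N, TangentSpace (𝓡 2) y)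
    (hframe : IsAdaptedFrame φ U V e₁ e₂ e₃ ε₁ ε₂)
    (f₁ f₂ k₁ k₂ σ : M → ℝ)
    (hdata : IsIntegrabilityData φ U V e₁ e₂ e₃ ε₁ ε₂ f₁ f₂ k₁ k₂ σ)
    (A B K : M → ℝ)
    (hA : A = coeffA e₁ e₂ f₁ f₂ k₁ k₂) (hB : B = coeffB e₁ e₂ f₁ f₂ k₁ k₂)
    (hK : K = fun x ↦ gaussCurvature (φ x)) :
    -- the Laplacian and the Gauss curvature in terms of the frame
    (∀ u : M → ℝ, ContMDiffOn (𝓡 3) 𝓘(ℝ, ℝ) ∞ u U → ∀ x ∈ U,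
      laplaceBeltrami (𝓡 3) u x =
        dirDeriv (𝓡 3) e₁ (dirDeriv (𝓡 3) e₁ u) x + dirDeriv (𝓡 3) e₂ (dirDeriv (𝓡 3) e₂ u) x
          + dirDeriv (𝓡 3) e₃ (dirDeriv (𝓡 3) e₃ u) x
          + f₁ x * dirDeriv (𝓡 3) e₂ u x - f₂ x * dirDeriv (𝓡 3) e₁ u x
          - k₁ x * dirDeriv (𝓡 3) e₁ u x - k₂ x * dirDeriv (𝓡 3) e₂ u x) ∧
    (∀ x ∈ U, K x =
      dirDeriv (𝓡 3) e₁ f₂ x - dirDeriv (𝓡 3) e₂ f₁ x - f₁ x ^ 2 - f₂ x ^ 2) ∧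
    -- the tension field and its rough Laplacian
    (∀ x ∈ U, tensionField (𝓡 3) (𝓡 2) φ x = - k₁ x • ε₁ (φ x) - k₂ x • ε₂ (φ x)) ∧
    (∀ x ∈ U, roughLaplacian (𝓡 3) (𝓡 2) φ (tensionField (𝓡 3) (𝓡 2) φ) x =
      A x • ε₁ (φ x) + B x • ε₂ (φ x)) ∧
    -- the triharmonic equation
    (IsTriharmonicOn (𝓡 3) (𝓡 2) φ U ↔
      ∀ x ∈ U,
        laplaceBeltrami (𝓡 3) A x
          + f₁ x * dirDeriv (𝓡 3) e₁ B x + dirDeriv (𝓡 3) e₁ (fun z ↦ B z * f₁ z) x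
          + f₂ x * dirDeriv (𝓡 3) e₂ B x + dirDeriv (𝓡 3) e₂ (fun z ↦ B z * f₂ z) x
          - f₁ x * k₁ x * B x - k₂ x * f₂ x * B x
          - A x * (K x + f₁ x ^ 2 + f₂ x ^ 2)
          + K x * (- dirDeriv (𝓡 3) e₂ k₁ x * k₂ x + dirDeriv (𝓡 3) e₂ k₂ x * k₁ x
            - k₁ x ^ 2 * f₂ x - k₂ x ^ 2 * f₂ x) = 0 ∧
        laplaceBeltrami (𝓡 3) B x
          - f₁ x * dirDeriv (𝓡 3) e₁ A x - dirDeriv (𝓡 3) e₁ (fun z ↦ A z * f₁ z) x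
          - f₂ x * dirDeriv (𝓡 3) e₂ A x - dirDeriv (𝓡 3) e₂ (fun z ↦ A z * f₂ z) x
          + f₁ x * k₁ x * A x + f₂ x * k₂ x * A x
          - B x * (K x + f₁ x ^ 2 + f₂ x ^ 2)
          + K x * (dirDeriv (𝓡 3) e₁ k₁ x * k₂ x - dirDeriv (𝓡 3) e₁ k₂ x * k₁ x
            + f₁ x * k₂ x ^ 2 + f₁ x * k₁ x ^ 2) = 0) := by
  obtain ⟨F₁, F₂, hF₁, hF₂, hbr, hf₁, hf₂⟩ := hdata.basic
  have h : IsAdaptedFrameWith φ U V e₁ e₂ e₃ ε₁ ε₂ f₁ f₂ k₁ k₂ σ F₁ F₂ :=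
    { smooth := hφ.contMDiff
      frame := hframe
      data := hdata
      surface := ⟨hframe.isOpen_target, hframe.smooth_ε₁, hframe.smooth_ε₂, hF₁, hF₂,
        hframe.orthonormal_ε, hbr⟩
      f₁_eq := hf₁
      f₂_eq := hf₂ }
  subst hK
  refine ⟨fun u hu x hx ↦ h.laplaceBeltrami_eq hu hx, fun x hx ↦ h.gaussCurvature_eq hx,
    fun x hx ↦ h.tensionField_eq hx, fun x hx ↦ ?_, forall₂_congr fun x hx ↦ ?_⟩
  · rw [hA, hB, h.roughLaplacian_tensionField hx]
  · rw [h.tritensionField_eq hA hB hx, h.comb_eq_zero_iff hx]
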